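/- **Setting.** Let $\mathcal C$ be a continuous-time Markov chain with finite state set $S$, initial state $s_I$, jump distributions $\Delta(s)$, exit rates $E(s)\ge 0$ and a labelling $L:S\to C$ of the states by colours. Put $R(s,s')=\Delta(s)(s')E(s)$ and let $\Pr_s(t)(s')$ be the $(s,s')$ entry of $e^{(R-\mathrm{diag}(E))t}$. Let $\mathbb P_{\mathcal C}$ be the law of the chain started in $s_I$, on paths $\pi:[0,\infty)\to S$. Let $w:S\to\mathbb R_{\ge0}$ be state weights. Imprecise evidence $\Omega=\langle\mathcal T_1,o_1\rangle,\dots,\langle\mathcal T_d,o_d\rangle$, $d\ge1$, consists of colours $o_i$ and non-empty sets $\mathcal T_i\subset(0,\infty)$, each a finite union of compact intervals, with $\max\mathcal T_i<\min\mathcal T_{i+1}$. An instance $\rho\in\Omega$ is a choice of times $t_i\in\mathcal T_i$; $\pi\models\rho$ means $L(\pi(t_i))=o_i$ for all $i$. Put $$W(\Omega)=\sup_{\rho\in\Omega}\sum_{s\in S}\mathbb P_{\mathcal C}\big(\pi(t_d)=s\mid\pi\models\rho\big)\,w(s),\qquad \tfrac00:=0 .$$ **Conditioned MDP.** Its states are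 $\langle s,t\rangle$ with $s\in S$ and $t\in\mathcal N=\{0\}\cup\bigcup_i\mathcal T_i\cup\{t_\star\}$, where $t_\star$ is a terminal symbol; the initial state is $\langle s_I,0\rangle$. The actions enabled in $\langle s,t\rangle$ are the $t'\in\mathcal T_1$ if $t=0$, the $t'\in\mathcal T_{i+1}$ if $t\in\mathcal T_i$ with $i<d$, and $t'=t_\star$ if $t\in\mathcal T_d$ or $t=t_\star$. If $t\in\mathcal T_i$ and $L(s)\ne o_i$, every action leads to $\langle s_I,0\rangle$ with probability one. Otherwise action $t'\neq t_\star$ leads to $\langle s',t'\rangle$ with probability $\Pr_s(t'-t)(s')$, and action $t_\star$ leads to $\langle s,t_\star\rangle$ with probability one. **Abstraction.** A time partition $\Psi$ consists of the elements $\{0\}$ and $\{t_\star\}$ and, for each $i$, a finite cover of $\mathcal T_i$ by subsets of $\mathcal T_i$ with pairwise disjoint interiors, together with a choice, for each $t\in\mathcal N$, of an element $\Psi(t)$ that contains $t$. The interval MDP $\mathcal I$ has the states $\langle s,\Psi(t)\rangle$ for $s\in S$, $t\in\mathcal N$, the initial state $\langle s_I,\{0\}\rangle$ and the actions $\Psi(t)$,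 $t\in\mathcal N$. The action $\mathcal T'$ is enabled in $\langle s,\mathcal T\rangle$ if $\Psi(t)=\mathcal T$, $\Psi(t')=\mathcal T'$ for some $t$ and some action $t'$ enabled in $\langle s,t\rangle$. For such $\mathcal T'$ and every state $\langle s',\mathcal T''\rangle$, the interval $\mathcal P(\langle s,\mathcal T\rangle,\mathcal T',\langle s',\mathcal T''\rangle)$ is the interval closure $[\inf,\sup]$ of the set of the probabilities with which the conditioned MDP moves from $\langle s,t\rangle$ under $t'$ into $\{\langle s',t''\rangle:\Psi(t'')=\mathcal T''\}$, over all $t$ with $\Psi(t)=\mathcal T$ and all actions $t'$ enabled in $\langle s,t\rangle$ with $\Psi(t')=\mathcal T'$. Write $\tilde P\in\mathcal P$ if, for every enabled action, $\tilde P$ gives a probability distribution over the states of $\mathcal I$ all of whose entries lie in the intervals. Let $\mathrm{Sched}^{\mathsf{con}}_{\mathcal I}$ be the set of memoryless schedulers $\sigma$ (choosing in each state an enabled action) with $\sigma(\langle s,\mathcal T\rangle)=\sigma(\langle s',\mathcal T\rangle)$ for all $s,s',\mathcal T$. Let $W_{\mathcal I}(\tilde P,\sigma)=\sum_{s\in S}\mathbb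 P^{\sigma}_{\mathcal I[\tilde P]}(\lozenge\langle s,t_\star\rangle)\,w(s)$, where $\mathbb P^{\sigma}_{\mathcal I[\tilde P]}$ is the law of the Markov chain on the states of $\mathcal I$ induced by $\tilde P$ and $\sigma$, started in the initial state, and $\lozenge q$ is the event that $q$ is ever visited. **Theorem.** The supremum $W(\Omega)$ is finite, all the maxima and minima below are attained, and $$\max_{\sigma\in \mathrm{Sched}^{\mathsf{con}}_{\mathcal I}}\ \min_{\tilde P\in\mathcal P}W_{\mathcal I}(\tilde P,\sigma)\;\le\;W(\Omega)\;\le\;\max_{\sigma\in \mathrm{Sched}^{\mathsf{con}}_{\mathcal I}}\ \max_{\tilde P\in\mathcal P}W_{\mathcal I}(\tilde P,\sigma).$$ -/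

import Mathlib

open MeasureTheory ProbabilityTheory Set
open scoped NNReal ENNReal

/-- A labelled continuous-time Markov chain with finite state set `S` and colours `C`. -/
structure CTMC (S C : Type*) [Fintype S] where
  /-- initial state -/
  init : S
  /-- jump probabilities: each row is a probability distribution -/
  trans : S → S → ℝ
  trans_nonneg : ∀ s s', 0 ≤ trans s s'
  trans_sum : ∀ s, ∑ s', trans s s' = 1
  /-- exit rates -/
  rate : S → ℝ≥0
  /-- labelling of the states by colours -/
  label : S → C

namespace CTMC

section Transient

variable {S C : Type*} [Fintype S] [DecidableEq S] (K : CTMC S C)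

/-- The transition rate matrix `R(s, s') = Δ(s)(s') · E(s)`. -/
def rateMatrix : Matrix S S ℝ :=
  Matrix.of fun s s' => K.trans s s' * (K.rate s : ℝ)

/-- The matrix `R - diag(E)`. -/
def generator : Matrix S S ℝ :=
  K.rateMatrix - Matrix.diagonal fun s => (K.rate s : ℝ)

/-- The matrix `exp ((R - diag(E)) t)`. -/
noncomputable def transientMatrix (t : ℝ≥0) : Matrix S S ℝ :=
  NormedSpace.exp ((t : ℝ) • K.generator)

lemma hasSum_exp_matrix (A : Matrix S S ℝ) :
    HasSum (fun n : ℕ => ((n.factorial : ℝ)⁻¹) • A ^ n) (NormedSpace.exp A) := by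
  let : NormedRing (Matrix S S ℝ) := Matrix.linftyOpNormedRing
  let : NormedAlgebra ℝ (Matrix S S ℝ) := Matrix.linftyOpNormedAlgebra
  exact NormedSpace.exp_series_hasSum_exp' (𝕂 := ℝ) A

lemma hasSum_exp_apply (A : Matrix S S ℝ) (s s' : S) :
    HasSum (fun n : ℕ => ((n.factorial : ℝ)⁻¹) * (A ^ n) s s') (NormedSpace.exp A s s') :=
  (Pi.hasSum.1 (Pi.hasSum.1 (hasSum_exp_matrix A) s)) s'

lemma exp_nonneg_of_nonneg (A : Matrix S S ℝ) (hA : ∀ s s', 0 ≤ A s s') (s s' : S) :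
    0 ≤ NormedSpace.exp A s s' := by
  have hpow : ∀ (n : ℕ) (s s' : S), 0 ≤ (A ^ n) s s' := by
    intro n
    induction n with
    | zero =>
      intro s s'
      rw [pow_zero, Matrix.one_apply]
      split_ifs <;> norm_num
    | succ n ih =>
      intro s s'
      rw [pow_succ, Matrix.mul_apply]
      exact Finset.sum_nonneg fun j _ => mul_nonneg (ih s j) (hA j s')
  exact (hasSum_exp_apply A s s').nonneg fun n => mul_nonneg (by positivity) (hpow n s s')

lemma transientMatrix_nonneg (t : ℝ≥0) (s s' : S) : 0 ≤ K.transientMatrix t s s' := by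
  set c : ℝ := t * ∑ s, (K.rate s : ℝ) with hc
  have hE : (t : ℝ) • K.generator
      = Matrix.diagonal (fun _ => -c) + ((t : ℝ) • K.generator + Matrix.diagonal (fun _ => c)) := by
    ext i j
    by_cases h : i = j
    · subst h; simp
    · simp [Matrix.diagonal_apply_ne _ h]
  have hcomm : Commute (Matrix.diagonal (fun _ : S => -c))
      ((t : ℝ) • K.generator + Matrix.diagonal (fun _ => c)) := by
    have : (Matrix.diagonal (fun _ : S => -c)) = algebraMap ℝ (Matrix S S ℝ) (-c) := by
      rw [Matrix.algebraMap_eq_diagonal]; rfl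
    rw [this]
    exact Algebra.commutes _ _
  rw [transientMatrix, hE, Matrix.exp_add_of_commute _ _ hcomm, Matrix.exp_diagonal,
    Matrix.diagonal_mul]
  refine mul_nonneg ?_ (exp_nonneg_of_nonneg _ ?_ s s')
  · rw [Pi.coe_exp, ← Real.exp_eq_exp_ℝ]
    exact (Real.exp_pos _).le
  · intro i j
    have h1 : 0 ≤ (t : ℝ) * (K.trans i j * (K.rate i : ℝ)) :=
      mul_nonneg t.2 (mul_nonneg (K.trans_nonneg i j) (K.rate i).2)
    by_cases h : i = j
    · subst h
      have h2 : (K.rate i : ℝ) ≤ ∑ s, (K.rate s : ℝ) :=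
        Finset.single_le_sum (f := fun s => (K.rate s : ℝ)) (fun s _ => (K.rate s).2)
          (Finset.mem_univ i)
      have h3 : (t : ℝ) * K.rate i ≤ c := mul_le_mul_of_nonneg_left h2 t.2
      simp only [generator, rateMatrix, Matrix.add_apply, Matrix.smul_apply, Matrix.sub_apply,
        Matrix.of_apply, Matrix.diagonal_apply_eq, smul_eq_mul]
      linarith
    · simpa [generator, rateMatrix, Matrix.diagonal_apply_ne _ h] using h1

lemma transientMatrix_sum (t : ℝ≥0) (s : S) : ∑ s', K.transientMatrix t s s' = 1 := by
  have hrow : ∀ i, ∑ j, ((t : ℝ) • K.generator) i j = 0 := by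
    intro i
    simp only [generator, rateMatrix, Matrix.smul_apply, Matrix.sub_apply, Matrix.of_apply,
      smul_eq_mul, ← Finset.mul_sum, Finset.sum_sub_distrib, ← Finset.sum_mul, K.trans_sum]
    simp [Matrix.diagonal_apply]
  have hpow : ∀ (n : ℕ) (i : S), ∑ j, (((t : ℝ) • K.generator) ^ (n + 1)) i j = 0 := by
    intro n i
    simp only [pow_succ, Matrix.mul_apply]
    rw [Finset.sum_comm]
    refine Finset.sum_eq_zero fun x _ => ?_
    rw [← Finset.mul_sum, hrow, mul_zero]
  have h1 := hasSum_sum (s := Finset.univ)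
    fun (s' : S) _ => hasSum_exp_apply ((t : ℝ) • K.generator) s s'
  have h2 : HasSum (fun n : ℕ => ∑ s', ((n.factorial : ℝ)⁻¹) * (((t : ℝ) • K.generator) ^ n) s s')
      1 := by
    convert hasSum_single (f := fun n : ℕ =>
      ∑ s', ((n.factorial : ℝ)⁻¹) * (((t : ℝ) • K.generator) ^ n) s s') 0 ?_ using 1
    · simp [Matrix.one_apply]
    · intro n hn
      obtain ⟨m, rfl⟩ := Nat.exists_eq_succ_of_ne_zero hn
      rw [← Finset.mul_sum, hpow, mul_zero]
  exact h1.unique h2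

lemma transientMatrix_add (a b : ℝ≥0) (s s' : S) :
    K.transientMatrix (a + b) s s'
      = ∑ v, K.transientMatrix a s v * K.transientMatrix b v s' := by
  have hc : Commute ((a : ℝ) • K.generator) ((b : ℝ) • K.generator) :=
    ((Commute.refl _).smul_left _).smul_right _
  rw [transientMatrix, NNReal.coe_add, add_smul, Matrix.exp_add_of_commute _ _ hc,
    Matrix.mul_apply]
  rfl

/-- The transient distribution `Pr_s(t)`: row `s` of `exp ((R - diag(E)) t)`. -/
noncomputable def transient (s : S) (t : ℝ≥0) : PMF S :=
  PMF.ofFintype (fun s' => ENNReal.ofReal (K.transientMatrix t s s')) (by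
    rw [← ENNReal.ofReal_sum_of_nonneg fun s' _ => K.transientMatrix_nonneg t s s',
      K.transientMatrix_sum, ENNReal.ofReal_one])

lemma transient_apply (s : S) (t : ℝ≥0) (s' : S) :
    K.transient s t s' = ENNReal.ofReal (K.transientMatrix t s s') := rfl

lemma transient_add (s : S) (a b : ℝ≥0) (s' : S) :
    K.transient s (a + b) s' = ∑ v, K.transient s a v * K.transient v b s' := by
  simp only [transient_apply]
  rw [transientMatrix_add, ENNReal.ofReal_sum_of_nonneg]
  · exact Finset.sum_congr rfl fun v _ => ENNReal.ofReal_mul (K.transientMatrix_nonneg _ _ _)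
  · exact fun v _ => mul_nonneg (K.transientMatrix_nonneg _ _ _) (K.transientMatrix_nonneg _ _ _)

lemma transient_sum (s : S) (t : ℝ≥0) : ∑ s', K.transient s t s' = 1 := by
  rw [← tsum_fintype (L := .unconditional _), PMF.tsum_coe]

end Transient

section PathLaw

variable {S C : Type*} [Fintype S] [DecidableEq S] (K : CTMC S C)

/-- For times `u ≤ t₁ ≤ t₂ ≤ …`, the product
`Pr_s(t₁ - u)(x t₁) · Pr_{x t₁}(t₂ - t₁)(x t₂) · …`. -/
noncomputable def pathWeight : S → ℝ≥0 → List ℝ≥0 → (ℝ≥0 → S) → ℝ≥0∞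
  | _, _, [], _ => 1
  | s, u, t :: l, x => K.transient s (t - u) (x t) * pathWeight (x t) t l x

lemma pathWeight_congr (s : S) (u : ℝ≥0) (l : List ℝ≥0) (x y : ℝ≥0 → S)
    (h : ∀ t ∈ l, x t = y t) : K.pathWeight s u l x = K.pathWeight s u l y := by
  induction l generalizing s u with
  | nil => rfl
  | cons t l ih =>
    rw [pathWeight, pathWeight, h t (by simp), ih _ _ fun t' ht' => h t' (by simp [ht'])]

lemma pathWeight_sum_update (s : S) (u : ℝ≥0) (l : List ℝ≥0) (x : ℝ≥0 → S) (t : ℝ≥0)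
    (hl : (u :: l).Pairwise (· ≤ ·)) (hn : l.Nodup) (ht : t ∈ l) :
    ∑ v, K.pathWeight s u l (Function.update x t v) = K.pathWeight s u (l.erase t) x := by
  induction l generalizing s u with
  | nil => simp at ht
  | cons r l ih =>
    have hl' : (r :: l).Pairwise (· ≤ ·) := (List.pairwise_cons.1 hl).2
    have hn' : l.Nodup := (List.nodup_cons.1 hn).2
    have hr : r ∉ l := (List.nodup_cons.1 hn).1
    by_cases hrt : r = t
    · subst hrt
      rw [List.erase_cons_head]
      cases l with
      | nil => simpa [pathWeight] using K.transient_sum s (r - u)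
      | cons q l =>
        have hq : q ≠ r := fun h => hr (by simp [h])
        have h1 : ∀ v, K.pathWeight s u (r :: q :: l) (Function.update x r v)
            = (K.transient s (r - u) v * K.transient v (q - r) (x q))
              * K.pathWeight (x q) q l x := by
          intro v
          rw [pathWeight, pathWeight, Function.update_self, Function.update_of_ne hq, mul_assoc,
            K.pathWeight_congr (x q) q l (Function.update x r v) x]
          intro t' ht'
          exact Function.update_of_ne (fun h => hr (by simp [← h, ht'])) _ _
        have hur : u ≤ r := (List.pairwise_cons.1 hl).1 r (by simp)
        have hrq : r ≤ q := (List.pairwise_cons.1 hl').1 q (by simp)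
        have hadd : q - u = (r - u) + (q - r) := by
          rw [add_comm]; exact (tsub_add_tsub_cancel hrq hur).symm
        simp_rw [h1]
        rw [← Finset.sum_mul, ← K.transient_add, ← hadd, pathWeight]
    · have ht' : t ∈ l := by
        rcases List.mem_cons.1 ht with h | h
        · exact absurd h.symm hrt
        · exact h
      rw [List.erase_cons_tail (by simpa using hrt)]
      simp only [pathWeight, Function.update_of_ne hrt]
      rw [← Finset.mul_sum, ih (x r) r hl' hn' ht']

/-- A total function that extends `x : I → S`. -/
noncomputable def extend (I : Finset ℝ≥0) (x : I → S) (t : ℝ≥0) : S :=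
  if h : t ∈ I then x ⟨t, h⟩ else K.init

variable [MeasurableSpace S]

/-- The joint law of the states of the chain (started in the initial state at time `0`) at the
finitely many times in `I`. -/
noncomputable def finiteLaw (I : Finset ℝ≥0) : Measure (I → S) :=
  ∑ x : I → S, K.pathWeight K.init 0 (I.sort (· ≤ ·)) (K.extend I x) • Measure.dirac x

lemma finiteLaw_insert (J : Finset ℝ≥0) (t : ℝ≥0) (ht : t ∉ J) :
    K.finiteLaw J
      = (K.finiteLaw (insert t J)).map (Finset.restrict₂ (π := fun _ => S) (Finset.subset_insert t J)) := by
  classical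
  have hm : Measurable (Finset.restrict₂ (π := fun _ : ℝ≥0 => S) (Finset.subset_insert t J)) :=
    Finset.measurable_restrict₂ _
  have hdir : ∀ x : (↥(insert t J)) → S, (Measure.dirac x).map
      (Finset.restrict₂ (π := fun _ : ℝ≥0 => S) (Finset.subset_insert t J))
      = Measure.dirac (Finset.restrict₂ (π := fun _ : ℝ≥0 => S) (Finset.subset_insert t J) x) :=
    fun x => Measure.map_dirac' hm x
  rw [finiteLaw, finiteLaw, ← Measure.mapₗ_apply_of_measurable hm, map_sum]
  simp only [Measure.mapₗ_apply_of_measurable hm, Measure.map_smul, hdir]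
  rw [← Finset.sum_fiberwise (s := Finset.univ)
    (g := Finset.restrict₂ (π := fun _ : ℝ≥0 => S) (Finset.subset_insert t J))]
  refine Finset.sum_congr rfl fun y _ => ?_
  have herase : ((insert t J).sort (· ≤ ·)).erase t = J.sort (· ≤ ·) := by
    refine List.Perm.eq_of_pairwise' (r := (· ≤ ·)) ?_ ?_ ?_
    · exact List.Pairwise.sublist List.erase_sublist (Finset.pairwise_sort _ _)
    · exact Finset.pairwise_sort _ _
    · refine (List.perm_ext_iff_of_nodup ((Finset.sort_nodup _ _).erase _)
        (Finset.sort_nodup _ _)).2 fun a => ?_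
      rw [(Finset.sort_nodup _ _).mem_erase_iff]
      simp only [Finset.mem_sort, Finset.mem_insert]
      constructor
      · rintro ⟨h1, h2 | h2⟩
        · exact absurd h2 h1
        · exact h2
      · exact fun h => ⟨fun h' => ht (h' ▸ h), Or.inr h⟩
  have hsum := K.pathWeight_sum_update K.init 0 ((insert t J).sort (· ≤ ·)) (K.extend J y) t
    (List.pairwise_cons.2 ⟨fun a _ => zero_le, Finset.pairwise_sort _ _⟩)
    (Finset.sort_nodup _ _) (by simp)
  rw [herase] at hsum
  rw [← hsum, Finset.sum_smul]
  refine Finset.sum_bij'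
    (fun v _ => fun i : (insert t J : Finset ℝ≥0) => Function.update (K.extend J y) t v i)
    (fun x _ => x ⟨t, Finset.mem_insert_self t J⟩) ?_ ?_ ?_ ?_ ?_
  · intro v _
    simp only [Finset.mem_filter, Finset.mem_univ, true_and]
    funext i
    have hi : (i : ℝ≥0) ≠ t := fun h => ht (h ▸ i.2)
    simp [Finset.restrict₂, Function.update_of_ne hi, extend]
  · intro x _
    simp
  · intro v _
    simp
  · intro x hx
    simp only [Finset.mem_filter, Finset.mem_univ, true_and] at hx
    funext i
    by_cases hi : (i : ℝ≥0) = t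
    · obtain ⟨i, h⟩ := i
      simp only at hi
      subst hi
      simp
    · have hiJ : (i : ℝ≥0) ∈ J := (Finset.mem_insert.1 i.2).resolve_left hi
      rw [Function.update_of_ne hi, extend, dif_pos hiJ, ← hx]
      rfl
  · intro v _
    have hres : Finset.restrict₂ (π := fun _ : ℝ≥0 => S) (Finset.subset_insert t J)
        (fun i => Function.update (K.extend J y) t v i) = y := by
      funext i
      have hi : (i : ℝ≥0) ≠ t := fun h => ht (h ▸ i.2)
      simp [Finset.restrict₂, Function.update_of_ne hi, extend]
    rw [hres]
    congr 1
    refine K.pathWeight_congr _ _ _ _ _ fun a ha => ?_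
    have ha' : a ∈ insert t J := (Finset.mem_sort _).1 ha
    simp only [extend, dif_pos ha']

lemma isProjective_finiteLaw :
    IsProjectiveMeasureFamily (α := fun _ : ℝ≥0 => S) K.finiteLaw := by
  classical
  have key : ∀ (L J : Finset ℝ≥0), Disjoint L J → ∀ h : J ⊆ L ∪ J,
      K.finiteLaw J = (K.finiteLaw (L ∪ J)).map (Finset.restrict₂ (π := fun _ => S) h) := by
    intro L
    induction L using Finset.induction_on with
    | empty =>
      intro J _ h
      have : ∀ (J' : Finset ℝ≥0) (hJ : J' = J) (h : J ⊆ J'),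
          K.finiteLaw J = (K.finiteLaw J').map (Finset.restrict₂ (π := fun _ => S) h) := by
        rintro _ rfl h
        exact Measure.map_id.symm
      exact this _ (Finset.empty_union J) h
    | insert t L htL ih =>
      intro J hd h
      have hd' : Disjoint L J := Finset.disjoint_of_subset_left (Finset.subset_insert t L) hd
      have htJ : t ∉ J := Finset.disjoint_left.1 hd (Finset.mem_insert_self t L)
      have htU : t ∉ L ∪ J := by simp [htL, htJ]
      have : ∀ (U : Finset ℝ≥0) (hU : U = insert t (L ∪ J)) (h : J ⊆ U),
          K.finiteLaw J = (K.finiteLaw U).map (Finset.restrict₂ (π := fun _ => S) h) := by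
        rintro _ rfl h
        rw [ih J hd' Finset.subset_union_right, K.finiteLaw_insert (L ∪ J) t htU,
          Measure.map_map (Finset.measurable_restrict₂ (X := fun _ => S) _)
            (Finset.measurable_restrict₂ (X := fun _ => S) _)]
        rfl
      exact this _ (Finset.insert_union t L J) h
  intro I J hJI
  have : ∀ (U : Finset ℝ≥0) (hU : U = (I \ J) ∪ J) (h : J ⊆ U),
      K.finiteLaw J = (K.finiteLaw U).map (Finset.restrict₂ (π := fun _ => S) h) := by
    rintro _ rfl h
    exact key _ _ Finset.sdiff_disjoint h
  exact this I (Finset.sdiff_union_of_subset hJI).symm hJI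

lemma finiteLaw_ne_top (I : Finset ℝ≥0) (A : Set (I → S)) : K.finiteLaw I A ≠ ∞ := by
  have hpw : ∀ (s : S) (u : ℝ≥0) (l : List ℝ≥0) (x : ℝ≥0 → S), K.pathWeight s u l x ≠ ∞ := by
    intro s u l x
    induction l generalizing s u with
    | nil => simp [pathWeight]
    | cons t l ih =>
      rw [pathWeight]
      exact ENNReal.mul_ne_top (PMF.apply_ne_top _ _) (ih _ _)
  rw [finiteLaw, Measure.finsetSum_apply]
  refine ENNReal.sum_ne_top.2 fun x _ => ?_
  rw [Measure.smul_apply, smul_eq_mul]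
  exact ENNReal.mul_ne_top (hpw _ _ _ _) (measure_ne_top _ _)

lemma isSigmaSubadditive_finiteLaw :
    (projectiveFamilyContent K.isProjective_finiteLaw).IsSigmaSubadditive := by
  refine isSigmaSubadditive_of_addContent_iUnion_eq_tsum
    isSetRing_measurableCylinders (fun f hf hf_Union hf' ↦ ?_)
  refine addContent_iUnion_eq_sum_of_tendsto_zero isSetRing_measurableCylinders
    _ ?_ ?_ hf hf_Union hf'
  · intro s hs
    obtain ⟨I, A, hA, rfl⟩ := (mem_measurableCylinders _).1 hs
    rw [projectiveFamilyContent_cylinder _ hA]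
    exact K.finiteLaw_ne_top I A
  · intro s hs hanti hinter
    let : TopologicalSpace S := ⊥
    have : DiscreteTopology S := ⟨rfl⟩
    have hclosed : ∀ n, IsClosed (s n) := by
      intro n
      obtain ⟨I, A, hA, h⟩ := (mem_measurableCylinders _).1 (hs n)
      rw [h]
      exact IsClosed.cylinder I (isClosed_discrete A)
    have hex : ∃ n, s n = ∅ := by
      by_contra hne
      push Not at hne
      have := IsCompact.nonempty_iInter_of_sequence_nonempty_isCompact_isClosed s
        (fun n => hanti (Nat.le_succ n)) hne (hclosed 0).isCompact hclosed
      rw [hinter] at this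
      exact Set.not_nonempty_empty this
    obtain ⟨n, hn⟩ := hex
    refine tendsto_atTop_of_eventually_const (i₀ := n) fun m hm => ?_
    have : s m = ∅ := Set.subset_empty_iff.1 (hn ▸ hanti hm)
    rw [this, addContent_empty]

/-- The probability measure `ℙ_C` of the chain on paths `π : ℝ≥0 → S`, where `π t` is the state at
time `t`: the measure on the product σ-algebra whose finite-dimensional marginals are given by the
initial state and the transient distributions. -/
noncomputable def pathLaw : Measure (ℝ≥0 → S) :=
  (projectiveFamilyContent K.isProjective_finiteLaw).measure isSetSemiring_measurableCylinders
    generateFrom_measurableCylinders.ge K.isSigmaSubadditive_finiteLaw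

/-- The finite-dimensional marginals of `pathLaw`. -/
lemma isProjectiveLimit_pathLaw :
    IsProjectiveLimit (α := fun _ : ℝ≥0 => S) K.pathLaw K.finiteLaw := by
  intro I
  ext A hA
  rw [Measure.map_apply (Finset.measurable_restrict I) hA, pathLaw, AddContent.measure_eq,
    projectiveFamilyContent_congr K.isProjective_finiteLaw (Finset.restrict (π := fun _ => S) I ⁻¹' A) rfl hA]
  · exact generateFrom_measurableCylinders.symm
  · exact cylinder_mem_measurableCylinders _ _ hA

end PathLaw
end CTMC

/-! ### Evidence -/

/-- Precisely timed evidence: `d + 1` observation times and observed colours. -/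
@[ext]
structure Evidence (C : Type*) (d : ℕ) where
  time : Fin (d + 1) → ℝ≥0
  label : Fin (d + 1) → C
  time_pos : ∀ i, 0 < time i
  time_strictMono : StrictMono time

/-- Imprecisely timed evidence: each of the `d + 1` observation times is only known to lie in a
non-empty finite union of compact intervals; the order of the observations is known. -/
structure ImpreciseEvidence (C : Type*) (d : ℕ) where
  time : Fin (d + 1) → Set ℝ≥0
  label : Fin (d + 1) → C
  time_eq : ∀ i, ∃ I : Finset (ℝ≥0 × ℝ≥0), I.Nonempty ∧ (∀ p ∈ I, p.1 ≤ p.2) ∧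
    time i = ⋃ p ∈ I, Icc p.1 p.2
  time_pos : ∀ i, ∀ t ∈ time i, 0 < t
  ordered : ∀ i j, i < j → ∀ t ∈ time i, ∀ t' ∈ time j, t < t'

namespace ImpreciseEvidence

variable {C : Type*} {d : ℕ} (Ω : ImpreciseEvidence C d)

/-- The instances `ρ ∈ Ω` of imprecise evidence. -/
def instances : Set (Evidence C d) :=
  {ρ | ρ.label = Ω.label ∧ ∀ i, ρ.time i ∈ Ω.time i}

lemma time_nonempty (i : Fin (d + 1)) : (Ω.time i).Nonempty := by
  obtain ⟨I, ⟨p, hp⟩, hle, h⟩ := Ω.time_eq i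
  rw [h]
  exact ⟨p.1, Set.mem_biUnion hp ⟨le_rfl, hle p hp⟩⟩

lemma instances_nonempty : Ω.instances.Nonempty := by
  choose f hf using Ω.time_nonempty
  exact ⟨⟨f, Ω.label, fun i => Ω.time_pos i _ (hf i),
    fun i j hij => Ω.ordered i j hij _ (hf i) _ (hf j)⟩, rfl, hf⟩

end ImpreciseEvidence

namespace CTMC

variable {S C : Type*} [Fintype S] [DecidableEq S] [MeasurableSpace S] (K : CTMC S C) {d : ℕ}

/-- The event `π ⊨ ρ`. -/
def consistentPaths (ρ : Evidence C d) : Set (ℝ≥0 → S) :=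
  {π | ∀ i, K.label (π (ρ.time i)) = ρ.label i}

/-- `ℙ_C (π(t_d) = s | π ⊨ ρ)`, where `t_d` is the last observation time (with `0 / 0 = 0`). -/
noncomputable def condProb (ρ : Evidence C d) (s : S) : ℝ :=
  K.pathLaw.real ({π | π (ρ.time (Fin.last d)) = s} ∩ K.consistentPaths ρ)
    / K.pathLaw.real (K.consistentPaths ρ)

/-- The weighted conditional reachability for one instance of the evidence. -/
noncomputable def instanceWeight (w : S → ℝ≥0) (ρ : Evidence C d) : ℝ :=
  ∑ s, K.condProb ρ s * (w s : ℝ)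

/-- The weighted conditional reachability `W(Ω)`. -/
noncomputable def weight (w : S → ℝ≥0) (Ω : ImpreciseEvidence C d) : ℝ :=
  sSup (K.instanceWeight w '' Ω.instances)

end CTMC

/-! ### Evidence graphs -/

/-- Nodes of evidence graphs: points in time and the terminal node `t⋆`. -/
inductive TimeNode where
  | time (t : ℝ≥0)
  | star

/-- The order of the nodes: by time, with the terminal node last. -/
def TimeNode.Before : TimeNode → TimeNode → Prop
  | .time t, .time t' => t < t'
  | .time _, .star => True
  | .star, _ => False

structure EvidenceGraph where
  nodes : Set TimeNode
  edges : Set (TimeNode × TimeNode)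
  zero_mem : TimeNode.time 0 ∈ nodes
  star_mem : TimeNode.star ∈ nodes
  edges_mem : ∀ e ∈ edges, e.1 ∈ nodes ∧ e.2 ∈ nodes
  edges_before : ∀ e ∈ edges, TimeNode.Before e.1 e.2

/-- The graph `0 → t₁ → ⋯ → t_d → t⋆` of precise evidence. -/
def Evidence.graph {C : Type*} {d : ℕ} (ρ : Evidence C d) : EvidenceGraph where
  nodes := {TimeNode.time 0, TimeNode.star} ∪ Set.range fun i => TimeNode.time (ρ.time i)
  edges := {(TimeNode.time 0, TimeNode.time (ρ.time 0)),
      (TimeNode.time (ρ.time (Fin.last d)), TimeNode.star)} ∪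
    Set.range fun i : Fin d =>
      (TimeNode.time (ρ.time i.castSucc), TimeNode.time (ρ.time i.succ))
  zero_mem := by simp
  star_mem := by simp
  edges_mem := by
    rintro e ((rfl | rfl) | ⟨i, rfl⟩) <;> simp
  edges_before := by
    rintro e ((rfl | rfl) | ⟨i, rfl⟩)
    · exact ρ.time_pos 0
    · exact trivial
    · exact ρ.time_strictMono Fin.castSucc_lt_succ

/-- The graph of imprecise evidence: the union of the graphs of its instances. -/
def ImpreciseEvidence.graph {C : Type*} {d : ℕ} (Ω : ImpreciseEvidence C d) : EvidenceGraph where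
  nodes := ⋃ ρ ∈ Ω.instances, ρ.graph.nodes
  edges := ⋃ ρ ∈ Ω.instances, ρ.graph.edges
  zero_mem := Set.mem_biUnion Ω.instances_nonempty.some_mem (EvidenceGraph.zero_mem _)
  star_mem := Set.mem_biUnion Ω.instances_nonempty.some_mem (EvidenceGraph.star_mem _)
  edges_mem := by
    intro e he
    obtain ⟨ρ, hρ, he⟩ := Set.mem_iUnion₂.1 he
    exact ⟨Set.mem_biUnion hρ (ρ.graph.edges_mem e he).1,
      Set.mem_biUnion hρ (ρ.graph.edges_mem e he).2⟩
  edges_before := by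
    intro e he
    obtain ⟨ρ, _, he⟩ := Set.mem_iUnion₂.1 he
    exact ρ.graph.edges_before e he

/-! ### Markov decision processes and interval Markov decision processes -/

/-- A Markov decision process. The values of `prob` at actions that are not enabled are
irrelevant. -/
structure MDP (Q A : Type*) where
  init : Q
  enabled : Q → Set A
  prob : Q → A → PMF Q

/-- An interval Markov decision process, with a set of transition probabilities for each
transition. -/
structure IMDP (Q A : Type*) where
  init : Q
  enabled : Q → Set A
  interval : Q → A → Q → Set ℝ

section Chain

variable {Q : Type*} [MeasurableSpace Q] [MeasurableSingletonClass Q] [Countable Q]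

/-- The transition kernel of the Markov chain with one-step distributions `κ`. -/
noncomputable def chainKernel (κ : Q → PMF Q) : Kernel Q Q :=
  Kernel.ofFunOfCountable fun q => (κ q).toMeasure

instance (κ : Q → PMF Q) : IsMarkovKernel (chainKernel κ) :=
  ⟨fun q => PMF.toMeasure.isProbabilityMeasure (κ q)⟩

/-- The law, on infinite paths, of the Markov chain with one-step distributions `κ` that is started
in `q₀`. -/
noncomputable def chainLaw (κ : Q → PMF Q) (q₀ : Q) : Measure (ℕ → Q) :=
  Kernel.trajMeasure (X := fun _ => Q) (Measure.dirac q₀)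
    fun n => (chainKernel κ).comap (fun x => x ⟨n, Finset.mem_Iic.2 le_rfl⟩) (measurable_pi_apply _)

/-- The probability `ℙ(◊ q)` that the Markov chain ever visits `q`. -/
noncomputable def reachProb (κ : Q → PMF Q) (q₀ q : Q) : ℝ :=
  (chainLaw κ q₀).real {ξ | ∃ n, ξ n = q}

end Chain

namespace IMDP

variable {Q A : Type*} (I : IMDP Q A)

/-- The transition functions `P̃ ∈ 𝒫`: all rows are distributions, and the probabilities of all
enabled transitions lie in the given sets. -/
def admissible : Set (Q → A → PMF Q) :=
  {P | ∀ q, ∀ a ∈ I.enabled q, ∀ q', (P q a q').toReal ∈ I.interval q a q'}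

/-- Memoryless schedulers. -/
def schedulers : Set (Q → A) :=
  {σ | ∀ q, σ q ∈ I.enabled q}

/-- For states that are pairs: the schedulers that choose the same action in any two states with
the same second component (the time). -/
def consistentSchedulers {S B : Type*} (I : IMDP (S × B) A) : Set (S × B → A) :=
  {σ | σ ∈ I.schedulers ∧ ∀ s s' b, σ (s, b) = σ (s', b)}

/-- The probability of ever visiting `q` in the Markov chain induced by the transition function `P`
and the scheduler `σ`. -/
noncomputable def reach [MeasurableSpace Q] [MeasurableSingletonClass Q] [Countable Q]
    (P : Q → A → PMF Q) (σ : Q → A) (q : Q) : ℝ :=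
  reachProb (fun q => P q (σ q)) I.init q

end IMDP

/-! ### Unfolding and conditioning -/

namespace CTMC

variable {S C : Type*} [Fintype S] [DecidableEq S] (K : CTMC S C)

/-- The distribution of the next state of the chain when moving from one node to the next (from a
terminal node there is no way back to a point in time, so the last value is irrelevant). -/
noncomputable def step (s : S) : TimeNode → TimeNode → PMF S
  | .time t, .time t' => K.transient s (t' - t)
  | _, .star => PMF.pure s
  | .star, .time _ => PMF.pure s

/-- The unfolded MDP over an evidence graph. The enabled actions are the successor nodes; the
terminal states are absorbing, i.e. their only action is to stay. -/
noncomputable def unfold (G : EvidenceGraph) : MDP (S × G.nodes) G.nodes where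
  init := (K.init, ⟨TimeNode.time 0, G.zero_mem⟩)
  enabled q := {t' | ((q.2 : TimeNode), (t' : TimeNode)) ∈ G.edges ∨
    ((q.2 : TimeNode) = TimeNode.star ∧ (t' : TimeNode) = TimeNode.star)}
  prob q t' := (K.step q.1 q.2 t').map fun s' => (s', t')

/-- The states `⟨s, t⟩` of the unfolded MDP whose label disagrees with the evidence at time `t`. -/
def resetStates {d : ℕ} (Ω : ImpreciseEvidence C d) : Set (S × Ω.graph.nodes) :=
  {q | ∃ i, ∃ t ∈ Ω.time i, (q.2 : TimeNode) = TimeNode.time t ∧ K.label q.1 ≠ Ω.label i}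

open Classical in
/-- The conditioned MDP: every action leads from a state that disagrees with the evidence back to
the initial state. -/
noncomputable def conditioned {d : ℕ} (Ω : ImpreciseEvidence C d) :
    MDP (S × Ω.graph.nodes) Ω.graph.nodes where
  init := (K.unfold Ω.graph).init
  enabled := (K.unfold Ω.graph).enabled
  prob q t' :=
    if q ∈ K.resetStates Ω then PMF.pure (K.unfold Ω.graph).init
    else (K.unfold Ω.graph).prob q t'

end CTMC

/-! ### Time partitions and abstraction -/

/-- A time partition `Ψ` of imprecise evidence: each set `Ω.time i` is covered by finitely many
cells with pairwise disjoint interiors. As cells may overlap at boundary points, `pick` records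
which of the cells that contain `t` is meant by `Ψ(t)`. -/
structure TimePartition {C : Type*} {d : ℕ} (Ω : ImpreciseEvidence C d) where
  count : Fin (d + 1) → ℕ
  cell : (i : Fin (d + 1)) → Fin (count i) → Set ℝ≥0
  cover : ∀ i, ⋃ j, cell i j = Ω.time i
  interior_disjoint : ∀ i j k, j ≠ k → Disjoint (interior (cell i j)) (interior (cell i k))
  pick : (t : ℝ≥0) → (∃ i, t ∈ Ω.time i) → Σ i, Fin (count i)
  mem_pick : ∀ t h, t ∈ cell (pick t h).1 (pick t h).2

namespace TimePartition

variable {C : Type*} {d : ℕ} {Ω : ImpreciseEvidence C d} (Ψ : TimePartition Ω)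

/-- The elements of the partition: the cells and the two elements for `0` and `t⋆`. -/
inductive Elem {C : Type*} {d : ℕ} {Ω : ImpreciseEvidence C d} (Ψ : TimePartition Ω) where
  | zero
  | star
  | cell (k : Σ i, Fin (Ψ.count i))

instance : Finite Ψ.Elem :=
  Finite.of_injective
    (fun e => match e with
      | .zero => none
      | .star => some none
      | .cell k => some (some k) : Ψ.Elem → Option (Option (Σ i, Fin (Ψ.count i))))
    (by rintro (_ | _ | k) (_ | _ | k') h <;> simp_all)

instance : MeasurableSpace Ψ.Elem := ⊤

instance : DiscreteMeasurableSpace Ψ.Elem := ⟨fun _ => trivial⟩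

open Classical in
/-- The element `Ψ(t)` of the partition that contains the node `t`. -/
noncomputable def elem : TimeNode → Ψ.Elem
  | .star => .star
  | .time t => if h : ∃ i, t ∈ Ω.time i then .cell (Ψ.pick t h) else .zero

/-- The elements `Ψ(t)` of the partition for the nodes `t` of the evidence graph. -/
abbrev AbsTime : Type := Set.range fun t : Ω.graph.nodes => Ψ.elem t

/-- The map `t ↦ Ψ(t)` on the nodes of the evidence graph. -/
noncomputable def absTime (t : Ω.graph.nodes) : Ψ.AbsTime :=
  ⟨Ψ.elem t, t, rfl⟩

/-- The abstract terminal time `t⋆`. -/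
noncomputable def absStar : Ψ.AbsTime :=
  Ψ.absTime ⟨TimeNode.star, Ω.graph.star_mem⟩

end TimePartition

/-- The iMDP abstraction that merges the states `⟨s, t⟩` of an MDP with the same value of `ψ t`. The
set for a transition is the interval closure of the probabilities with which the merged states
move, by actions in the preimage of the abstract action, to (the preimage of) the abstract
target state. -/
noncomputable def MDP.abstract {S N B : Type*} (M : MDP (S × N) N) (ψ : N → B) :
    IMDP (S × B) B where
  init := Prod.map id ψ M.init
  enabled q := {b | ∃ t t', ψ t = q.2 ∧ t' ∈ M.enabled (q.1, t) ∧ ψ t' = b}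
  interval q b q' :=
    let V : Set ℝ := {x | ∃ t t', ψ t = q.2 ∧ t' ∈ M.enabled (q.1, t) ∧ ψ t' = b ∧
      x = ((M.prob (q.1, t) t').map (Prod.map id ψ) q').toReal}
    Icc (sInf V) (sSup V)

namespace CTMC

variable {S C : Type*} [Fintype S] [DecidableEq S] (K : CTMC S C)
  {d : ℕ} {Ω : ImpreciseEvidence C d}

/-- The abstraction `ℐ` of the conditioned MDP for the time partition `Ψ`. -/
noncomputable def abstraction (Ψ : TimePartition Ω) : IMDP (S × Ψ.AbsTime) Ψ.AbsTime :=
  (K.conditioned Ω).abstract Ψ.absTime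

/-- The value `W_ℐ(P̃, σ) = ∑ s, ℙ(◊ ⟨s, t⋆⟩) · w(s)` in the Markov chain induced by `P̃` and `σ`. -/
noncomputable def abstractWeight [MeasurableSpace S] [MeasurableSingletonClass S] (w : S → ℝ≥0)
    (Ψ : TimePartition Ω) (P : S × Ψ.AbsTime → Ψ.AbsTime → PMF (S × Ψ.AbsTime))
    (σ : S × Ψ.AbsTime → Ψ.AbsTime) : ℝ :=
  ∑ s, (K.abstraction Ψ).reach P σ (s, Ψ.absStar) * (w s : ℝ)

end CTMC

/-! A consistent scheduler ignores the state, so until a reset the induced chain runs through one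
fixed sequence of partition elements. Every pair of times from consecutive observation sets is an
edge of the evidence graph, so a time may be picked from each visited element independently of the
others, and the picks form an instance. Conversely, each instance is followed by some consistent
scheduler (`exists_instance_of_scheduler`, `exists_scheduler_of_instance`).

Along such a sequence the chain performs rejection sampling: a run that contradicts an observation
restarts, and a run that survives all observations is absorbed in the terminal state that records
its final state. Hence the absorption probabilities are the unnormalised filtering masses divided by
their sum (`reachProb_layered`), with value 0 if the sum vanishes, in accordance with the convention
for 0/0. By the Markov property of the path law, the conditional probabilities given an instance are
the same expression in the transient matrices (`pathLaw_real_eq_forwardMass`, `instanceWeight_eq`).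
The concrete probabilities of an instance are admissible, so its weight is one of the values of any
scheduler that follows it (`instanceWeight_mem_image`). It therefore lies between the minimum and
the maximum for that scheduler, which gives both inequalities.

Attainment for a fixed scheduler needs continuity of a quotient on the compact set of admissible
transition functions. The zero pattern of a transient matrix is the same at all positive times
(`transientMatrix_eq_zero`), and the observation sets are compact and separated in time, so the
entries that do not vanish are bounded away from 0. All admissible functions thus have the same
support on the relevant rows (`admissible_support`), and the denominator vanishes for all of them or
for none. Attainment over schedulers is finiteness, and the supremum is bounded by the sum of all
weights. -/

/-! ### One-step and initial distributions of the Markov chain law -/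

section ChainLaw

variable {Q : Type*} [MeasurableSpace Q] [MeasurableSingletonClass Q] [Countable Q]

instance (κ : Q → PMF Q) (q₀ : Q) : IsProbabilityMeasure (chainLaw κ q₀) := by
  unfold chainLaw; infer_instance

/-- The law of the next state together with the history up to time `n` is a composition-product; on
the histories that end in `q` the kernel is constant. -/
lemma chainLaw_joint (κ : Q → PMF Q) (q₀ : Q) (n : ℕ) (q q' : Q) :
    chainLaw κ q₀ {ξ | ξ n = q ∧ ξ (n + 1) = q'} = chainLaw κ q₀ {ξ | ξ n = q} * κ q q' := by
  have h := Kernel.map_frestrictLe_trajMeasure_compProd_eq_map_trajMeasure (X := fun _ => Q)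
    (μ₀ := Measure.dirac q₀)
    (κ := fun n => (chainKernel κ).comap (fun x => x ⟨n, Finset.mem_Iic.2 le_rfl⟩)
      (measurable_pi_apply _)) (a := n)
  have hA : MeasurableSet {x : (i : Finset.Iic n) → Q | x ⟨n, Finset.mem_Iic.2 le_rfl⟩ = q} :=
    measurable_pi_apply (X := fun _ : Finset.Iic n => Q) _ (measurableSet_singleton q)
  have h2 := congrArg (fun μ => μ ({x | x ⟨n, Finset.mem_Iic.2 le_rfl⟩ = q} ×ˢ {q'})) h
  beta_reduce at h2
  rw [Measure.compProd_apply_prod hA (measurableSet_singleton q'),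
    Measure.map_apply (by fun_prop) (hA.prod (measurableSet_singleton q')),
    setLIntegral_congr_fun (g := fun _ => κ q q') hA, setLIntegral_const,
    Measure.map_apply (by fun_prop) hA, mul_comm] at h2
  · exact h2.symm
  · intro x hx
    simp only [mem_ofPred_eq] at hx
    beta_reduce
    rw [Kernel.comap_apply, hx]
    exact PMF.toMeasure_apply_singleton _ _ (measurableSet_singleton _)

lemma chainLaw_zero [DecidableEq Q] (κ : Q → PMF Q) (q₀ q : Q) :
    chainLaw κ q₀ {ξ | ξ 0 = q} = if q₀ = q then 1 else 0 := by
  have hm : MeasurableSet {x : (i : Finset.Iic 0) → Q | x ⟨0, Finset.mem_Iic.2 le_rfl⟩ = q} :=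
    measurable_pi_apply (X := fun _ : Finset.Iic 0 => Q) _ (measurableSet_singleton q)
  have h1 : {ξ : ℕ → Q | ξ 0 = q} = Preorder.frestrictLe (π := fun _ => Q) 0 ⁻¹'
    {x : (i : Finset.Iic 0) → Q | x ⟨0, Finset.mem_Iic.2 le_rfl⟩ = q} := rfl
  rw [h1, ← Measure.map_apply (by fun_prop) hm, chainLaw, Kernel.trajMeasure,
    Measure.map_dirac, Measure.dirac_bind (Kernel.measurable _),
    Kernel.traj_map_frestrictLe_apply, Kernel.partialTraj_self, Kernel.id_apply,
    Measure.dirac_apply' _ hm]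
  by_cases h : q₀ = q
  · rw [if_pos h, indicator_of_mem (by exact h)]; rfl
  · rw [if_neg h, indicator_of_notMem (by exact h)]

end ChainLaw

/-- The transition matrix of the Markov chain with one-step distributions `κ`. -/
noncomputable def chainMatrix {Q : Type*} (κ : Q → PMF Q) : Matrix Q Q ℝ :=
  Matrix.of fun q q' => (κ q q').toReal

lemma chainMatrix_sum {Q : Type*} [Fintype Q] (κ : Q → PMF Q) (q : Q) :
    ∑ q', chainMatrix κ q q' = 1 := by
  have h := PMF.tsum_coe (κ q)
  rw [tsum_fintype] at h
  simp only [chainMatrix, Matrix.of_apply]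
  rw [← ENNReal.toReal_sum fun a _ => PMF.apply_ne_top _ _, h, ENNReal.toReal_one]

/-! ### Finite chains: matrix powers and absorption -/

section FiniteChain

variable {Q : Type*} [MeasurableSpace Q] [MeasurableSingletonClass Q] [Fintype Q] [DecidableEq Q]

lemma chainLaw_real_eval (κ : Q → PMF Q) (q₀ q : Q) (n : ℕ) :
    (chainLaw κ q₀).real {ξ | ξ n = q} = (chainMatrix κ ^ n) q₀ q := by
  induction n generalizing q with
  | zero =>
    rw [measureReal_def, chainLaw_zero, pow_zero, Matrix.one_apply]
    split_ifs <;> simp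
  | succ n ih =>
    have hm : ∀ (m : ℕ) (a : Q), MeasurableSet {ξ : ℕ → Q | ξ m = a} := fun m a =>
      measurable_pi_apply (X := fun _ : ℕ => Q) m (measurableSet_singleton a)
    have hU : {ξ : ℕ → Q | ξ (n + 1) = q}
        = ⋃ a ∈ (Finset.univ : Finset Q), {ξ | ξ n = a ∧ ξ (n + 1) = q} := by
      ext ξ; simp
    rw [hU, measureReal_biUnion_finset, pow_succ, Matrix.mul_apply]
    · refine Finset.sum_congr rfl fun a _ => ?_
      rw [← ih, measureReal_def, chainLaw_joint, ENNReal.toReal_mul]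
      rfl
    · intro a _ b _ hab
      rw [Function.onFun, Set.disjoint_left]
      rintro ξ ⟨h1, _⟩ ⟨h2, _⟩
      exact hab (h1.symm.trans h2)
    · exact fun a _ => (hm n a).inter (hm (n + 1) q)

/-- The probability of having reached an absorbing state after `n` steps converges to the
reachability probability. -/
lemma tendsto_reachProb (κ : Q → PMF Q) (q₀ q : Q) (hq : κ q = PMF.pure q) :
    Filter.Tendsto (fun n => (chainMatrix κ ^ n) q₀ q) Filter.atTop
      (nhds (reachProb κ q₀ q)) := by
  -- Almost surely `q` is never left, so being in `q` at time `n` is the same as having visited it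
  -- by then. These events increase to the reachability event, and continuity from below applies.
  have hae : ∀ᵐ ξ ∂(chainLaw κ q₀), ∀ n, ξ n = q → ξ (n + 1) = q := by
    rw [ae_all_iff]
    intro n
    have : {ξ : ℕ → Q | ¬ (ξ n = q → ξ (n + 1) = q)}
        ⊆ ⋃ a ∈ {a : Q | a ≠ q}, {ξ | ξ n = q ∧ ξ (n + 1) = a} := by
      intro ξ hξ
      simp only [mem_ofPred_eq, Classical.not_imp] at hξ
      exact mem_biUnion (x := ξ (n + 1)) hξ.2 ⟨hξ.1, rfl⟩
    refine measure_mono_null this ?_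
    refine (measure_biUnion_null_iff (Set.to_countable _)).2 fun a ha => ?_
    rw [chainLaw_joint, hq, PMF.pure_apply, if_neg ha, mul_zero]
  have hacc : ∀ n, (chainMatrix κ ^ n) q₀ q
      = (chainLaw κ q₀).real (Set.accumulate (fun n => {ξ : ℕ → Q | ξ n = q}) n) := by
    intro n
    rw [← chainLaw_real_eval, measureReal_def, measureReal_def]
    congr 1
    refine measure_congr ?_
    filter_upwards [hae] with ξ hξ
    refine propext ⟨fun h => ?_, fun h => ?_⟩
    · exact Set.subset_accumulate h
    · obtain ⟨m, hm, hmq⟩ := Set.mem_accumulate.1 h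
      induction n, hm using Nat.le_induction with
      | base => exact hmq
      | succ k hk ih => exact hξ k (ih (Set.mem_accumulate.2 ⟨m, hk, hmq⟩))
  simp_rw [hacc]
  have hU : {ξ : ℕ → Q | ∃ n, ξ n = q} = ⋃ n, {ξ : ℕ → Q | ξ n = q} := by ext; simp
  rw [reachProb, hU]
  exact (ENNReal.tendsto_toReal (measure_ne_top _ _)).comp
    tendsto_measure_iUnion_accumulate

end FiniteChain

/-! ### Filtering masses -/

/-- Filtering: `forwardMass A ok s₀ k s` is the total weight of the runs `s₀, s₁, …, s_k = s` with
`ok j s_j` for `1 ≤ j ≤ k`, where the `j`-th step has weight `A j`. -/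
noncomputable def forwardMass {S : Type*} [Fintype S] [DecidableEq S] (A : ℕ → S → S → ℝ)
    (ok : ℕ → S → Prop) (s₀ : S) : ℕ → S → ℝ
  | 0, s => if s = s₀ then 1 else 0
  | k + 1, s => open Classical in
      if ok (k + 1) s then ∑ v, forwardMass A ok s₀ k v * A k v s else 0

section ForwardMass

variable {S : Type*} [Fintype S] [DecidableEq S] {A B : ℕ → S → S → ℝ} {ok : ℕ → S → Prop} {s₀ : S}

lemma forwardMass_of_not_ok {k : ℕ} {s : S} (h0 : ok 0 s₀) (h : ¬ ok k s) :
    forwardMass A ok s₀ k s = 0 := by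
  cases k with
  | zero => rw [forwardMass, if_neg]; exact fun hs => h (hs ▸ h0)
  | succ k => rw [forwardMass, if_neg h]

lemma forwardMass_nonneg {n : ℕ} (hA : ∀ k < n, ∀ s s', 0 ≤ A k s s') :
    ∀ k ≤ n, ∀ s, 0 ≤ forwardMass A ok s₀ k s := by
  intro k
  induction k with
  | zero => intro _ s; rw [forwardMass]; split_ifs <;> norm_num
  | succ k ih =>
    intro hk s
    rw [forwardMass]
    split_ifs
    · exact Finset.sum_nonneg fun v _ => mul_nonneg (ih (by omega) v) (hA k (by omega) v s)
    · exact le_rfl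

/-- Rejected states carry no mass, so their rows never enter. -/
lemma forwardMass_congr (h0 : ok 0 s₀) {n : ℕ}
    (hAB : ∀ k < n, ∀ s, ok k s → ∀ s', A k s s' = B k s s') :
    ∀ k ≤ n, ∀ s, forwardMass A ok s₀ k s = forwardMass B ok s₀ k s := by
  intro k
  induction k with
  | zero => intro _ s; rfl
  | succ k ih =>
    intro hk s
    rw [forwardMass, forwardMass]
    congr 1
    refine Finset.sum_congr rfl fun v _ => ?_
    by_cases hv : ok k v
    · rw [ih (by omega), hAB k (by omega) v hv]
    · rw [forwardMass_of_not_ok h0 hv, forwardMass_of_not_ok h0 hv, zero_mul, zero_mul]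

/-- A vanishing sum of nonnegative terms vanishes termwise, so the zeros of the mass depend only on
the zeros of the rows at accepted states. -/
lemma forwardMass_eq_zero_of_support (h0 : ok 0 s₀) {n : ℕ}
    (hA : ∀ k < n, ∀ s s', 0 ≤ A k s s')
    (hAB : ∀ k < n, ∀ s, ok k s → ∀ s', A k s s' = 0 → B k s s' = 0) :
    ∀ k ≤ n, ∀ s, forwardMass A ok s₀ k s = 0 → forwardMass B ok s₀ k s = 0 := by
  intro k
  induction k with
  | zero => intro _ s h; exact h
  | succ k ih =>
    intro hk s h
    rw [forwardMass] at h ⊢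
    split_ifs at h ⊢ with hs
    · refine Finset.sum_eq_zero fun v _ => ?_
      have hv := (Finset.sum_eq_zero_iff_of_nonneg fun v _ =>
        mul_nonneg (forwardMass_nonneg hA k (by omega) v) (hA k (by omega) v s)).1 h v
        (Finset.mem_univ v)
      rcases mul_eq_zero.1 hv with hv | hv
      · rw [ih (by omega) v hv, zero_mul]
      · by_cases hok : ok k v
        · rw [hAB k (by omega) v hok s hv, mul_zero]
        · rw [forwardMass_of_not_ok h0 hok, zero_mul]
    · rfl

end ForwardMass

/-! ### Reachability in a chain with restarts -/

section Layered

variable {S Q : Type*} [Fintype S] [DecidableEq S] [MeasurableSpace Q] [MeasurableSingletonClass Q]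
  [Fintype Q] [DecidableEq Q]

/-- Reachability of the absorbing states of a layered chain that is reset to its initial state from
the states that are not `ok`. -/
lemma reachProb_layered (κ : Q → PMF Q) (e : ℕ → S → Q) (ok : ℕ → S → Prop) (s₀ : S) (n : ℕ)
    (A : ℕ → S → S → ℝ) (h0 : ok 0 s₀)
    (hstep : ∀ k < n, ∀ s, ok k s → ∀ φ : Q → ℝ,
      ∑ q, chainMatrix κ (e k s) q * φ q = ∑ s', A k s s' * φ (e (k + 1) s'))
    (hreset : ∀ k ≤ n, ∀ s, ¬ ok k s → κ (e k s) = PMF.pure (e 0 s₀))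
    (hlast : ∀ s, ok n s → κ (e n s) = PMF.pure (e (n + 1) s))
    (hstar : ∀ s, κ (e (n + 1) s) = PMF.pure (e (n + 1) s))
    (hne : ∀ k ≤ n, ∀ s s', e k s ≠ e (n + 1) s')
    (hinj : Function.Injective (e (n + 1))) (hA : ∀ k < n, ∀ s s', 0 ≤ A k s s') (s : S) :
    reachProb κ (e 0 s₀) (e (n + 1) s)
      = forwardMass A ok s₀ n s / ∑ s', forwardMass A ok s₀ n s' := by
  set t := e (n + 1) s with ht
  have hnn := forwardMass_nonneg (ok := ok) (s₀ := s₀) hA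
  have hsucc : ∀ m q, (chainMatrix κ ^ (m + 1)) q t
      = ∑ q', chainMatrix κ q q' * (chainMatrix κ ^ m) q' t := fun m q => by
    rw [pow_succ', Matrix.mul_apply]
  have hpure : ∀ m q q', κ q = PMF.pure q' →
      (chainMatrix κ ^ (m + 1)) q t = (chainMatrix κ ^ m) q' t := by
    intro m q q' h
    rw [hsucc, Finset.sum_eq_single q']
    · simp [chainMatrix, h]
    · intro b _ hb
      simp [chainMatrix, h, hb]
    · simp
  by_cases hD : ∑ s', forwardMass A ok s₀ n s' = 0
  · rw [hD, div_zero]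
    have hz : ∀ v, forwardMass A ok s₀ n v = 0 := fun v =>
      (Finset.sum_eq_zero_iff_of_nonneg fun v _ => hnn n le_rfl v).1 hD v (Finset.mem_univ v)
    -- If no accepted run survives, the states of stages up to `n` that carry mass or are rejected
    -- form a set the chain cannot leave. It contains the start and no terminal state.
    have key : ∀ m, ∀ k ≤ n, ∀ v, (forwardMass A ok s₀ k v ≠ 0 ∨ ¬ ok k v) →
        (chainMatrix κ ^ m) (e k v) t = 0 := by
      intro m
      induction m with
      | zero => intro k hk v _; rw [pow_zero, Matrix.one_apply, if_neg (hne k hk v s)]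
      | succ m ih =>
        intro k hk v hv
        by_cases hok : ok k v
        · have hv' : forwardMass A ok s₀ k v ≠ 0 := hv.resolve_right (not_not.2 hok)
          have hkn : k < n := lt_of_le_of_ne hk fun h => hv' (h ▸ hz v)
          rw [hsucc, hstep k hkn v hok]
          refine Finset.sum_eq_zero fun v' _ => ?_
          by_cases hAv : A k v v' = 0
          · rw [hAv, zero_mul]
          · rw [ih (k + 1) hkn v', mul_zero]
            by_cases hok' : ok (k + 1) v'
            · left
              rw [forwardMass, if_pos hok']
              refine (lt_of_lt_of_le ?_ (Finset.single_le_sum (f := fun v =>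
                forwardMass A ok s₀ k v * A k v v') (fun v _ => mul_nonneg (hnn k hk v)
                (hA k hkn v v')) (Finset.mem_univ v))).ne'
              exact mul_pos ((hnn k hk v).lt_of_ne' hv') ((hA k hkn v v').lt_of_ne' hAv)
            · exact Or.inr hok'
        · rw [hpure m _ _ (hreset k hk v hok)]
          exact ih 0 (Nat.zero_le n) s₀ (Or.inl (by simp [forwardMass]))
    refine tendsto_nhds_unique (tendsto_reachProb κ (e 0 s₀) t (hstar s)) ?_
    simp_rw [fun m => key m 0 (Nat.zero_le n) s₀ (Or.inl (by simp [forwardMass]))]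
    exact tendsto_const_nhds
  · rw [eq_div_iff hD]
    -- The reachability probability as a function of the starting state is harmonic: shift the index
    -- in the limit of matrix powers.
    set H : Q → ℝ := fun q => reachProb κ q t with hH
    have hlim : ∀ q, Filter.Tendsto (fun m => (chainMatrix κ ^ m) q t) Filter.atTop
      (nhds (H q)) := fun q => tendsto_reachProb κ q t (hstar s)
    have hharm : ∀ q, H q = ∑ q', chainMatrix κ q q' * H q' := by
      intro q
      refine tendsto_nhds_unique ((hlim q).comp (Filter.tendsto_add_atTop_nat 1)) ?_
      simp only [Function.comp_def, hsucc]
      exact tendsto_finsetSum _ fun q' _ => (hlim q').const_mul _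
    have hHpure : ∀ q q', κ q = PMF.pure q' → H q = H q' := by
      intro q q' h
      refine tendsto_nhds_unique ((hlim q).comp (Filter.tendsto_add_atTop_nat 1)) ?_
      simp only [Function.comp_def, hpure _ _ _ h]
      exact hlim q'
    have hA1 : ∀ k < n, ∀ v, ok k v → ∑ v', A k v v' = 1 := by
      intro k hk v hv
      -- The constant test function shows that the rows of `A` at accepted states sum to one.
      have := hstep k hk v hv fun _ => 1
      simpa [chainMatrix_sum] using this.symm
    -- Harmonicity unrolled along the stages: the mass missing at stage `k` has been rejected, and
    -- each rejected run has the value of the initial state again. In the induction step,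
    -- subtracting that value makes the contributions of rejected states vanish.
    have key : ∀ k ≤ n, H (e 0 s₀) = ∑ v, forwardMass A ok s₀ k v * H (e k v)
        + (1 - ∑ v, forwardMass A ok s₀ k v) * H (e 0 s₀) := by
      intro k
      induction k with
      | zero => intro _; simp [forwardMass]
      | succ k ih =>
        intro hk
        have ih := ih (by omega)
        have e1 : ∀ v, forwardMass A ok s₀ k v * (H (e k v) - H (e 0 s₀))
            = ∑ v', forwardMass A ok s₀ k v * A k v v' * (H (e (k + 1) v') - H (e 0 s₀)) := by
          intro v
          by_cases hv : ok k v
          · rw [hharm (e k v), hstep k (by omega) v hv]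
            simp only [mul_sub, Finset.sum_sub_distrib, ← Finset.sum_mul, mul_assoc,
              ← Finset.mul_sum]
            rw [hA1 k (by omega) v hv, one_mul]
          · simp [forwardMass_of_not_ok h0 hv]
        have e2 : ∀ v', forwardMass A ok s₀ (k + 1) v' * (H (e (k + 1) v') - H (e 0 s₀))
            = ∑ v, forwardMass A ok s₀ k v * A k v v' * (H (e (k + 1) v') - H (e 0 s₀)) := by
          intro v'
          rw [← Finset.sum_mul]
          by_cases hv : ok (k + 1) v'
          · rw [forwardMass, if_pos hv]
          · rw [hHpure _ _ (hreset (k + 1) hk v' hv), sub_self, mul_zero, mul_zero]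
        have e3 := Finset.sum_congr rfl fun v (_ : v ∈ Finset.univ) => e1 v
        have e4 := Finset.sum_congr rfl fun v (_ : v ∈ Finset.univ) => e2 v
        rw [Finset.sum_comm, ← e4] at e3
        simp only [mul_sub, Finset.sum_sub_distrib, ← Finset.sum_mul] at e3
        linarith
    have hn := key n le_rfl
    -- An accepted state of the last stage moves to its own absorbing copy, so `H` is an indicator
    -- there. The identity `hn` then says that the total mass times the value at the start is the
    -- mass at `s`.
    have hfin : ∀ v, forwardMass A ok s₀ n v * H (e n v)
        = if v = s then forwardMass A ok s₀ n s else 0 := by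
      intro v
      by_cases hv : ok n v
      · have hHv : H (e n v) = if v = s then 1 else 0 := by
          rw [hHpure _ _ (hlast v hv)]
          refine tendsto_nhds_unique (hlim _) ?_
          have : ∀ m, (chainMatrix κ ^ m) (e (n + 1) v) t = if v = s then 1 else 0 := by
            intro m
            induction m with
            | zero => rw [pow_zero, Matrix.one_apply, ht]; simp only [hinj.eq_iff]
            | succ m ih => rw [hpure m _ _ (hstar v), ih]
          simp_rw [this]
          exact tendsto_const_nhds
        rw [hHv]
        split_ifs with h <;> simp [h]
      · rw [forwardMass_of_not_ok h0 hv, zero_mul]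
        split_ifs with h
        · rw [← h, forwardMass_of_not_ok h0 hv]
        · rfl
    simp_rw [hfin] at hn
    simp only [Finset.sum_ite_eq', Finset.mem_univ, if_true] at hn
    change H (e 0 s₀) * _ = _
    linarith

end Layered

/-! ### Finite-dimensional marginals and the Markov property of the path law -/

namespace CTMC

section Marginals

variable {S C : Type*} [Fintype S] [DecidableEq S] (K : CTMC S C)

lemma transientMatrix_zero : K.transientMatrix 0 = 1 := by
  rw [transientMatrix, NNReal.coe_zero, zero_smul, NormedSpace.exp_zero]

lemma transient_toReal (s : S) (t : ℝ≥0) (s' : S) :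
    (K.transient s t s').toReal = K.transientMatrix t s s' := by
  rw [transient_apply, ENNReal.toReal_ofReal (K.transientMatrix_nonneg t s s')]

lemma pathWeight_append (s : S) (u : ℝ≥0) (l : List ℝ≥0) (a b : ℝ≥0) (x : ℝ≥0 → S) :
    K.pathWeight s u (l ++ [a, b]) x
      = K.pathWeight s u (l ++ [a]) x * K.transient (x a) (b - a) (x b) := by
  induction l generalizing s u with
  | nil => simp [pathWeight]
  | cons t l ih => simp only [List.cons_append, pathWeight, ih, mul_assoc]

variable [MeasurableSpace S] [MeasurableSingletonClass S]

instance : IsFiniteMeasure K.pathLaw := by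
  have : ∀ I, IsFiniteMeasure (K.finiteLaw I) := fun I =>
    ⟨lt_top_iff_ne_top.2 (K.finiteLaw_ne_top I _)⟩
  exact K.isProjectiveLimit_pathLaw.isFiniteMeasure

/-- The event is a cylinder over a single point, and in the finite marginal, a weighted sum of point
masses, only one summand charges that point. -/
lemma pathLaw_eq_pathWeight (l : List ℝ≥0) (hl : l.Pairwise (· < ·)) (x : ℝ≥0 → S) :
    K.pathLaw {π | ∀ t ∈ l, π t = x t} = K.pathWeight K.init 0 l x := by
  have hn : l.Nodup := hl.imp fun h => h.ne
  have hsort : l.toFinset.sort (· ≤ ·) = l :=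
    (List.toFinset_sort (· ≤ ·) hn).2 (hl.imp fun h => h.le)
  have hset : {π : ℝ≥0 → S | ∀ t ∈ l, π t = x t}
      = l.toFinset.restrict (π := fun _ => S) ⁻¹' {fun i : l.toFinset => x i} := by
    ext π
    simp [funext_iff, Finset.restrict]
  rw [hset, ← Measure.map_apply (Finset.measurable_restrict _) (measurableSet_singleton _),
    K.isProjectiveLimit_pathLaw, finiteLaw, Measure.finsetSum_apply,
    Finset.sum_eq_single (fun i : l.toFinset => x i)]
  · rw [Measure.smul_apply, Measure.dirac_apply_of_mem (by rfl), smul_eq_mul, mul_one, hsort]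
    refine K.pathWeight_congr _ _ _ _ _ fun t ht => ?_
    rw [extend, dif_pos (List.mem_toFinset.2 ht)]
  · intro y _ hy
    rw [Measure.smul_apply, Measure.dirac_apply' _ (measurableSet_singleton _),
      indicator_of_notMem (by exact hy), smul_zero]
  · simp

/-- The Markov property at the last of finitely many times. -/
lemma pathLaw_markov (l : List ℝ≥0) (a b : ℝ≥0) (hl : (l ++ [a, b]).Pairwise (· < ·))
    (I : Finset ℝ≥0) (hI : I = (l ++ [a]).toFinset) (B : Set (I → S)) (s s' : S) :
    K.pathLaw {π | (I.restrict π ∈ B ∧ π a = s) ∧ π b = s'}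
      = K.pathLaw {π | I.restrict π ∈ B ∧ π a = s} * K.transient s (b - a) s' := by
  classical
  have haI : a ∈ I := by simp [hI]
  have hl2 : (l ++ [a]) ++ [b] = l ++ [a, b] := by simp
  have hl1 : (l ++ [a]).Pairwise (· < ·) := by
    rw [← hl2] at hl; exact (List.pairwise_append.1 hl).1
  have hbI : b ∉ I := by
    intro hb
    rw [← hl2] at hl
    exact lt_irrefl b ((List.pairwise_append.1 hl).2.2 b (List.mem_toFinset.1 (hI ▸ hb)) b
      (by simp))
  have hmI : ∀ y : I → S, MeasurableSet {π : ℝ≥0 → S | I.restrict π = y} := fun y =>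
    Finset.measurable_restrict (X := fun _ => S) I (measurableSet_singleton y)
  have hmb : MeasurableSet {π : ℝ≥0 → S | π b = s'} :=
    measurable_pi_apply (X := fun _ => S) b (measurableSet_singleton s')
  -- Both events split into finitely many full specifications of the path on `I`; for each of them,
  -- appending the time `b` multiplies the path weight by one transient factor.
  set F : Finset (I → S) := Finset.univ.filter fun y => y ∈ B ∧ y ⟨a, haI⟩ = s with hF
  have h1 : {π : ℝ≥0 → S | (I.restrict π ∈ B ∧ π a = s) ∧ π b = s'}
      = ⋃ y ∈ F, {π | I.restrict π = y ∧ π b = s'} := by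
    ext π
    simp [hF, Finset.restrict]
  have h2 : {π : ℝ≥0 → S | I.restrict π ∈ B ∧ π a = s} = ⋃ y ∈ F, {π | I.restrict π = y} := by
    ext π
    simp [hF, Finset.restrict]
  have e2 : ∀ y : I → S, {π : ℝ≥0 → S | I.restrict π = y}
      = {π | ∀ t ∈ l ++ [a], π t = K.extend I y t} := by
    intro y
    ext π
    simp only [mem_ofPred_eq, funext_iff, Finset.restrict, Subtype.forall]
    refine forall_congr' fun t => ?_
    have hmem : t ∈ l ++ [a] ↔ t ∈ I := by rw [hI, List.mem_toFinset]
    rw [hmem]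
    refine forall_congr' fun ht => ?_
    rw [extend, dif_pos ht]
  have e1 : ∀ y : I → S, {π : ℝ≥0 → S | I.restrict π = y ∧ π b = s'}
      = {π | ∀ t ∈ l ++ [a, b], π t = Function.update (K.extend I y) b s' t} := by
    intro y
    have : {π : ℝ≥0 → S | I.restrict π = y ∧ π b = s'}
      = {π | I.restrict π = y} ∩ {π | π b = s'} := rfl
    rw [this, e2, ← hl2]
    ext π
    simp only [mem_inter_iff, mem_ofPred_eq, List.mem_append (t := [b]), List.mem_singleton, or_imp,
      forall_and, forall_eq, Function.update_self]
    refine and_congr_left fun _ => forall_congr' fun t => forall_congr' fun ht => ?_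
    rw [Function.update_of_ne]
    rintro rfl
    exact hbI (hI ▸ List.mem_toFinset.2 ht)
  rw [h1, h2, measure_biUnion_finset, measure_biUnion_finset, Finset.sum_mul]
  · refine Finset.sum_congr rfl fun y hy => ?_
    rw [e1, e2, K.pathLaw_eq_pathWeight _ hl, K.pathLaw_eq_pathWeight _ hl1, pathWeight_append,
      Function.update_self, Function.update_of_ne (a := a) (ne_of_mem_of_not_mem haI hbI)]
    congr 1
    · refine K.pathWeight_congr _ _ _ _ _ fun t ht => ?_
      rw [Function.update_of_ne]
      rintro rfl
      exact hbI (hI ▸ List.mem_toFinset.2 ht)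
    · rw [extend, dif_pos haI, (Finset.mem_filter.1 hy).2.2]
  · intro y _ y' _ hne
    rw [Function.onFun, Set.disjoint_left]
    exact fun π h h' => hne (h.symm.trans h')
  · exact fun y _ => hmI y
  · intro y _ y' _ hne
    rw [Function.onFun, Set.disjoint_left]
    exact fun π h h' => hne (h.1.symm.trans h'.1)
  · exact fun y _ => (hmI y).inter hmb

/-- The joint weights of the observations and the current state are given by filtering. -/
lemma pathLaw_real_eq_forwardMass (ok : ℕ → S → Prop) (h0 : ok 0 K.init) (τ : ℕ → ℝ≥0)
    (hτ0 : τ 0 = 0) {n : ℕ} (hτ : ∀ j k, j < k → k ≤ n → τ j < τ k) :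
    ∀ k ≤ n, ∀ s, K.pathLaw.real {π | (∀ j ≤ k, ok j (π (τ j))) ∧ π (τ k) = s}
      = forwardMass (fun k s s' => K.transientMatrix (τ (k + 1) - τ k) s s') ok K.init k s := by
  have hmt : ∀ (t : ℝ≥0) (A : Set S), MeasurableSet {π : ℝ≥0 → S | π t ∈ A} := fun t A =>
    measurable_pi_apply (X := fun _ => S) t A.toFinite.measurableSet
  have hmE : ∀ k, MeasurableSet {π : ℝ≥0 → S | ∀ j ≤ k, ok j (π (τ j))} := by
    intro k
    have : {π : ℝ≥0 → S | ∀ j ≤ k, ok j (π (τ j))}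
        = ⋂ j, ⋂ (_ : j ≤ k), {π | π (τ j) ∈ {s | ok j s}} := by
      ext π; simp
    rw [this]
    exact MeasurableSet.iInter fun j => MeasurableSet.iInter fun _ => hmt _ _
  intro k
  induction k with
  | zero =>
    intro _ s
    -- The transient matrix at time 0 is the identity, so the chain starts almost surely in its
    -- initial state.
    have hz : ∀ v : S, K.pathLaw {π | π 0 = v} = if v = K.init then 1 else 0 := by
      intro v
      have := K.pathLaw_eq_pathWeight [0] (by simp) fun _ => v
      simp only [List.mem_singleton, forall_eq, pathWeight, mul_one, tsub_zero, transient_apply,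
        transientMatrix_zero, Matrix.one_apply] at this
      rw [this]
      simp only [eq_comm (a := v)]
      split_ifs <;> simp
    rw [forwardMass, measureReal_def]
    simp only [nonpos_iff_eq_zero, forall_eq, hτ0]
    by_cases hs : s = K.init
    · have : {π : ℝ≥0 → S | ok 0 (π 0) ∧ π 0 = s} = {π | π 0 = s} := by
        ext π
        simp only [mem_ofPred_eq, and_iff_right_iff_imp]
        intro h
        rw [h, hs]; exact h0
      rw [this, hz, if_pos hs, if_pos hs, ENNReal.toReal_one]
    · rw [if_neg hs, measure_mono_null (t := {π : ℝ≥0 → S | π 0 = s}) (fun π h => h.2)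
        (by rw [hz, if_neg hs]), ENNReal.toReal_zero]
  | succ k ih =>
    intro hk s
    rw [forwardMass]
    split_ifs with hs
    · have hset : {π : ℝ≥0 → S | (∀ j ≤ k + 1, ok j (π (τ j))) ∧ π (τ (k + 1)) = s}
          = ⋃ v ∈ (Finset.univ : Finset S),
            {π | ((∀ j ≤ k, ok j (π (τ j))) ∧ π (τ k) = v) ∧ π (τ (k + 1)) = s} := by
        ext π
        simp only [mem_ofPred_eq, Finset.mem_univ, iUnion_true, mem_iUnion]
        constructor
        · exact fun h => ⟨_, ⟨fun j hj => h.1 j (by omega), rfl⟩, h.2⟩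
        · rintro ⟨v, ⟨h1, _⟩, h2⟩
          refine ⟨fun j hj => ?_, h2⟩
          rcases Nat.le_succ_iff.1 hj with h | rfl
          · exact h1 j h
          · rw [Nat.succ_eq_add_one, h2]; exact hs
      rw [hset, measureReal_biUnion_finset]
      · refine Finset.sum_congr rfl fun v _ => ?_
        rw [← ih (by omega), ← K.transient_toReal, measureReal_def, measureReal_def,
          ← ENNReal.toReal_mul]
        congr 1
        have hl : ((List.range k).map τ ++ [τ k, τ (k + 1)]) = (List.range (k + 2)).map τ := by
          rw [List.range_succ, List.range_succ]; simp
        have hl' : ((List.range k).map τ ++ [τ k]) = (List.range (k + 1)).map τ := by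
          rw [List.range_succ]; simp
        have hpw : ((List.range k).map τ ++ [τ k, τ (k + 1)]).Pairwise (· < ·) := by
          rw [hl, List.pairwise_map]
          refine List.pairwise_lt_range.imp_of_mem fun {i j} _ hj h => hτ i j h ?_
          have := List.mem_range.1 hj
          omega
        have hmem : ∀ j ≤ k, τ j ∈ ((List.range k).map τ ++ [τ k]).toFinset := by
          intro j hj
          rw [hl', List.mem_toFinset]
          exact List.mem_map_of_mem (List.mem_range.2 (by omega))
        exact K.pathLaw_markov ((List.range k).map τ) (τ k) (τ (k + 1)) hpw _ rfl
          {y | ∀ j, ∀ hj : j ≤ k, ok j (y ⟨τ j, hmem j hj⟩)} v s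
      · intro v _ v' _ hv
        rw [Function.onFun, Set.disjoint_left]
        exact fun π h h' => hv (h.1.2.symm.trans h'.1.2)
      · exact fun v _ => ((hmE k).inter (hmt _ {v})).inter (hmt _ {s})
    · have : {π : ℝ≥0 → S | (∀ j ≤ k + 1, ok j (π (τ j))) ∧ π (τ (k + 1)) = s} = ∅ := by
        refine Set.eq_empty_of_forall_notMem fun π h => hs ?_
        rw [← h.2]
        exact h.1 (k + 1) le_rfl
      rw [this, measureReal_empty]

end Marginals

/-! ### Conditional probabilities as normalised filtering masses -/

section Evidence

variable {S C : Type*} [Fintype S] {d : ℕ}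

/-- A state agrees with the `k`-th observation; the stages before and after the observations impose
no condition. -/
def agrees (K : CTMC S C) (o : Fin (d + 1) → C) : ℕ → S → Prop
  | 0, _ => True
  | k + 1, s => ∀ h : k < d + 1, K.label s = o ⟨k, h⟩

end Evidence

end CTMC

/-- The times of the stages: stage `0` is at time `0`, stage `k + 1` is the `k`-th observation. -/
def Evidence.stageTime {C : Type*} {d : ℕ} (ρ : Evidence C d) : ℕ → ℝ≥0
  | 0 => 0
  | k + 1 => if h : k < d + 1 then ρ.time ⟨k, h⟩ else 0

lemma Evidence.stageTime_lt {C : Type*} {d : ℕ} (ρ : Evidence C d) (j k : ℕ) (hjk : j < k)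
    (hk : k ≤ d + 1) : ρ.stageTime j < ρ.stageTime k := by
  obtain ⟨k, rfl⟩ := Nat.exists_eq_succ_of_ne_zero (by omega : k ≠ 0)
  rw [stageTime, dif_pos (by omega)]
  cases j with
  | zero => exact ρ.time_pos _
  | succ j =>
    rw [stageTime, dif_pos (by omega)]
    exact ρ.time_strictMono (by simpa using hjk)

lemma CTMC.instanceWeight_eq {S C : Type*} [Fintype S] [DecidableEq S] [MeasurableSpace S]
    [MeasurableSingletonClass S] (K : CTMC S C) (w : S → ℝ≥0) {d : ℕ} (ρ : Evidence C d) :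
    K.instanceWeight w ρ = ∑ s, forwardMass
        (fun k s s' => K.transientMatrix (ρ.stageTime (k + 1) - ρ.stageTime k) s s')
        (K.agrees ρ.label) K.init (d + 1) s
      / (∑ s, forwardMass
        (fun k s s' => K.transientMatrix (ρ.stageTime (k + 1) - ρ.stageTime k) s s')
        (K.agrees ρ.label) K.init (d + 1) s) * (w s : ℝ) := by
  have key := K.pathLaw_real_eq_forwardMass (K.agrees ρ.label) trivial ρ.stageTime rfl
    ρ.stageTime_lt (d + 1) le_rfl
  have hcons : K.consistentPaths ρ
      = {π | ∀ j ≤ d + 1, K.agrees ρ.label j (π (ρ.stageTime j))} := by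
    ext π
    constructor
    · intro h j hj
      cases j with
      | zero => trivial
      | succ j =>
        intro hj'
        rw [Evidence.stageTime, dif_pos hj']
        exact h ⟨j, hj'⟩
    · intro h i
      have := h (i + 1) (by omega) i.2
      rwa [Evidence.stageTime, dif_pos i.2] at this
  have hlast : ρ.time (Fin.last d) = ρ.stageTime (d + 1) := by
    rw [Evidence.stageTime, dif_pos (Nat.lt_succ_self d)]; rfl
  have hm : ∀ s, K.pathLaw.real ({π | π (ρ.time (Fin.last d)) = s} ∩ K.consistentPaths ρ)
      = forwardMass (fun k s s' => K.transientMatrix (ρ.stageTime (k + 1) - ρ.stageTime k) s s')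
        (K.agrees ρ.label) K.init (d + 1) s := by
    intro s
    rw [← key, hcons, hlast, Set.inter_comm]
    rfl
  -- The normalising constant: split the consistent paths according to their state at the last
  -- observation.
  have hD : K.pathLaw.real (K.consistentPaths ρ) = ∑ s, forwardMass
        (fun k s s' => K.transientMatrix (ρ.stageTime (k + 1) - ρ.stageTime k) s s')
        (K.agrees ρ.label) K.init (d + 1) s := by
    simp_rw [← hm]
    have hmt : ∀ (t : ℝ≥0) (s : S), MeasurableSet {π : ℝ≥0 → S | π t = s} := fun t s =>
      measurable_pi_apply (X := fun _ => S) t (measurableSet_singleton s)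
    have hmc : MeasurableSet (K.consistentPaths ρ) := by
      have : K.consistentPaths ρ
          = ⋂ i, (fun π => π (ρ.time i)) ⁻¹' {s | K.label s = ρ.label i} := by
        ext π; simp [CTMC.consistentPaths]
      rw [this]
      exact MeasurableSet.iInter fun i => measurable_pi_apply (X := fun _ => S) _
        (Set.toFinite _).measurableSet
    rw [← measureReal_biUnion_finset]
    · congr 1
      ext π; simp
    · intro s _ s' _ hs
      rw [Function.onFun, Set.disjoint_left]
      exact fun π h h' => hs (h.1.symm.trans h'.1)
    · exact fun s _ => (hmt _ s).inter hmc
  simp only [CTMC.instanceWeight, CTMC.condProb, hm, hD]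

/-! ### Stages of imprecise evidence -/

namespace ImpreciseEvidence

variable {C : Type*} {d : ℕ} (Ω : ImpreciseEvidence C d)

/-- The possible times of a stage: stage `0` is at time `0`, stage `k + 1` is the `k`-th
observation, and there are no times after the last observation. -/
def stageTimes : ℕ → Set ℝ≥0
  | 0 => {0}
  | k + 1 => if h : k < d + 1 then Ω.time ⟨k, h⟩ else ∅

/-- The nodes of a stage; all stages after the last observation consist of the terminal node. -/
def stage (k : ℕ) : Set TimeNode :=
  if k ≤ d + 1 then TimeNode.time '' Ω.stageTimes k else {TimeNode.star}

lemma stageTimes_succ (i : Fin (d + 1)) : Ω.stageTimes (i + 1) = Ω.time i := by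
  rw [stageTimes, dif_pos i.2]

lemma stageTimes_lt {j k : ℕ} (hjk : j < k) {t t' : ℝ≥0} (ht : t ∈ Ω.stageTimes j)
    (ht' : t' ∈ Ω.stageTimes k) : t < t' := by
  obtain ⟨k, rfl⟩ := Nat.exists_eq_succ_of_ne_zero (by omega : k ≠ 0)
  rw [Nat.succ_eq_add_one, stageTimes] at ht'
  split_ifs at ht' with hk
  · cases j with
    | zero => rw [mem_singleton_iff.1 ht]; exact Ω.time_pos _ _ ht'
    | succ j =>
      rw [stageTimes, dif_pos (by omega)] at ht
      exact Ω.ordered _ _ (by simpa using hjk) _ ht _ ht'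
  · exact ht'.elim

lemma isCompact_stageTimes (k : ℕ) : IsCompact (Ω.stageTimes k) := by
  cases k with
  | zero => exact isCompact_singleton
  | succ k =>
    rw [stageTimes]
    split_ifs with hk
    · obtain ⟨I, _, _, h⟩ := Ω.time_eq ⟨k, hk⟩
      rw [h]
      exact I.finite_toSet.isCompact_biUnion fun p _ => isCompact_Icc
    · exact isCompact_empty

lemma stage_of_le {k : ℕ} (hk : k ≤ d + 1) : Ω.stage k = TimeNode.time '' Ω.stageTimes k :=
  if_pos hk

lemma stage_of_lt {k : ℕ} (hk : d + 1 < k) : Ω.stage k = {TimeNode.star} :=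
  if_neg (not_le.2 hk)

lemma stage_zero : Ω.stage 0 = {TimeNode.time 0} := by
  rw [stage_of_le _ (by omega), stageTimes, image_singleton]

lemma stage_nonempty (k : ℕ) : (Ω.stage k).Nonempty := by
  by_cases hk : k ≤ d + 1
  · rw [stage_of_le _ hk]
    refine Set.Nonempty.image _ ?_
    cases k with
    | zero => exact singleton_nonempty _
    | succ k => rw [stageTimes, dif_pos (by omega)]; exact Ω.time_nonempty _
  · rw [stage_of_lt _ (by omega)]
    exact singleton_nonempty _

/-- Stages are indexed by all natural numbers, and those beyond `d + 1` coincide; truncation at `d +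
2` is the normal form of an index. -/
lemma stage_eq_of_min_eq {j k : ℕ} (h : min j (d + 2) = min k (d + 2)) :
    Ω.stage j = Ω.stage k := by
  by_cases hj : j ≤ d + 1
  · rw [show j = k by omega]
  · rw [stage_of_lt _ (by omega), stage_of_lt _ (by omega)]

end ImpreciseEvidence

namespace Evidence

variable {C : Type*} {d : ℕ}

/-- The nodes of precise evidence in their order, followed by the terminal node. -/
def stageNode (ρ : Evidence C d) (k : ℕ) : TimeNode :=
  if k ≤ d + 1 then TimeNode.time (ρ.stageTime k) else TimeNode.star

lemma stageNode_zero (ρ : Evidence C d) : ρ.stageNode 0 = TimeNode.time 0 := by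
  rw [stageNode, if_pos (by omega), stageTime]

lemma stageNode_succ (ρ : Evidence C d) (i : Fin (d + 1)) :
    ρ.stageNode (i + 1) = TimeNode.time (ρ.time i) := by
  rw [stageNode, if_pos (by omega), stageTime, dif_pos i.2]

lemma stageNode_of_lt (ρ : Evidence C d) {k : ℕ} (hk : d + 1 < k) :
    ρ.stageNode k = TimeNode.star := if_neg (not_le.2 hk)

lemma mem_graph_nodes (ρ : Evidence C d) (n : TimeNode) :
    n ∈ ρ.graph.nodes ↔ ∃ k, n = ρ.stageNode k := by
  constructor
  · rintro ((rfl | rfl) | ⟨i, rfl⟩)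
    · exact ⟨0, ρ.stageNode_zero.symm⟩
    · exact ⟨d + 2, (ρ.stageNode_of_lt (by omega)).symm⟩
    · exact ⟨i + 1, (ρ.stageNode_succ i).symm⟩
  · rintro ⟨k, rfl⟩
    by_cases hk : k ≤ d + 1
    · cases k with
      | zero => rw [stageNode_zero]; exact ρ.graph.zero_mem
      | succ k =>
        rw [ρ.stageNode_succ ⟨k, by omega⟩]
        exact Or.inr ⟨_, rfl⟩
    · rw [stageNode_of_lt _ (by omega)]; exact ρ.graph.star_mem

lemma mem_graph_edges (ρ : Evidence C d) (n n' : TimeNode) :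
    (n, n') ∈ ρ.graph.edges ↔ ∃ k ≤ d + 1, n = ρ.stageNode k ∧ n' = ρ.stageNode (k + 1) := by
  constructor
  · rintro ((h | h) | ⟨i, h⟩)
    · obtain ⟨rfl, rfl⟩ := Prod.mk.inj h
      exact ⟨0, by omega, ρ.stageNode_zero.symm, (ρ.stageNode_succ 0).symm⟩
    · obtain ⟨rfl, rfl⟩ := Prod.mk.inj h
      exact ⟨d + 1, le_rfl, (ρ.stageNode_succ (Fin.last d)).symm,
        (ρ.stageNode_of_lt (by omega)).symm⟩
    · obtain ⟨rfl, rfl⟩ := Prod.mk.inj h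
      exact ⟨i + 1, by omega, (ρ.stageNode_succ i.castSucc).symm, (ρ.stageNode_succ i.succ).symm⟩
  · rintro ⟨k, hk, rfl, rfl⟩
    rcases Nat.eq_zero_or_pos k with rfl | hk0
    · refine Or.inl (Or.inl ?_)
      rw [stageNode_zero, show (0 : ℕ) + 1 = ((0 : Fin (d + 1)) : ℕ) + 1 from rfl, stageNode_succ]
    · obtain ⟨k, rfl⟩ := Nat.exists_eq_add_one_of_ne_zero hk0.ne'
      rcases (Nat.succ_le_succ_iff.1 hk).eq_or_lt with h | hkd
      · refine Or.inl (Or.inr ?_)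
        have h1 : ρ.stageNode (k + 1) = TimeNode.time (ρ.time (Fin.last d)) := by
          rw [h]; exact ρ.stageNode_succ (Fin.last d)
        have h2 : ρ.stageNode (k + 1 + 1) = TimeNode.star := ρ.stageNode_of_lt (by omega)
        exact Prod.ext h1 h2
      · exact Or.inr ⟨⟨k, hkd⟩, Prod.ext (ρ.stageNode_succ (Fin.castSucc ⟨k, hkd⟩)).symm
          (ρ.stageNode_succ (Fin.succ ⟨k, hkd⟩)).symm⟩

end Evidence

namespace ImpreciseEvidence

variable {C : Type*} {d : ℕ} (Ω : ImpreciseEvidence C d)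

lemma stageNode_mem_stage {ρ : Evidence C d} (hρ : ρ ∈ Ω.instances) (k : ℕ) :
    ρ.stageNode k ∈ Ω.stage k := by
  by_cases hk : k ≤ d + 1
  · cases k with
    | zero => rw [stage_zero, ρ.stageNode_zero]; rfl
    | succ k =>
      rw [ρ.stageNode_succ ⟨k, by omega⟩, stage_of_le _ hk]
      refine mem_image_of_mem _ ?_
      rw [stageTimes, dif_pos (by omega)]
      exact hρ.2 _
  · rw [stage_of_lt _ (by omega), ρ.stageNode_of_lt (by omega)]; rfl

/-- The observation sets are separated in time, so times chosen independently are automatically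
increasing. -/
lemma exists_instance_of_stages (f : ℕ → TimeNode) (hf : ∀ k, f k ∈ Ω.stage k) :
    ∃ ρ ∈ Ω.instances, ∀ k, ρ.stageNode k = f k := by
  have h : ∀ i : Fin (d + 1), ∃ t ∈ Ω.time i, TimeNode.time t = f (i + 1) := by
    intro i
    have := hf (i + 1)
    rwa [stage_of_le _ (by omega), stageTimes_succ] at this
  choose t ht htf using h
  refine ⟨⟨t, Ω.label, fun i => Ω.time_pos i _ (ht i),
    fun i j hij => Ω.ordered i j hij _ (ht i) _ (ht j)⟩, ⟨rfl, ht⟩, fun k => ?_⟩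
  by_cases hk : k ≤ d + 1
  · cases k with
    | zero =>
      have := hf 0
      rw [stage_zero] at this
      rw [Evidence.stageNode_zero, mem_singleton_iff.1 this]
    | succ k =>
      exact (Evidence.stageNode_succ _ ⟨k, by omega⟩).trans (htf ⟨k, by omega⟩)
  · have := hf k
    rw [stage_of_lt _ (by omega)] at this
    rw [Evidence.stageNode_of_lt _ (by omega), mem_singleton_iff.1 this]

lemma mem_graph_nodes (n : TimeNode) : n ∈ Ω.graph.nodes ↔ ∃ k, n ∈ Ω.stage k := by
  classical
  constructor
  · intro h
    obtain ⟨ρ, hρ, h⟩ := Set.mem_iUnion₂.1 h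
    obtain ⟨k, rfl⟩ := (ρ.mem_graph_nodes n).1 h
    exact ⟨k, Ω.stageNode_mem_stage hρ k⟩
  · rintro ⟨k, hk⟩
    choose g hg using Ω.stage_nonempty
    obtain ⟨ρ, hρ, h⟩ := Ω.exists_instance_of_stages (Function.update g k n) (fun j => by
      rcases eq_or_ne j k with rfl | hj
      · rwa [Function.update_self]
      · rw [Function.update_of_ne hj]; exact hg j)
    refine Set.mem_biUnion hρ ((ρ.mem_graph_nodes n).2 ⟨k, ?_⟩)
    rw [h, Function.update_self]

/-- With the loop at the terminal node included, the graph is complete between consecutive stages: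
any two nodes there extend to an instance by arbitrary choices elsewhere. -/
lemma mem_graph_edges_or (n n' : TimeNode) :
    ((n, n') ∈ Ω.graph.edges ∨ (n = TimeNode.star ∧ n' = TimeNode.star))
      ↔ ∃ k, n ∈ Ω.stage k ∧ n' ∈ Ω.stage (k + 1) := by
  classical
  constructor
  · rintro (h | ⟨rfl, rfl⟩)
    · obtain ⟨ρ, hρ, h⟩ := Set.mem_iUnion₂.1 h
      obtain ⟨k, _, rfl, rfl⟩ := (ρ.mem_graph_edges n n').1 h
      exact ⟨k, Ω.stageNode_mem_stage hρ k, Ω.stageNode_mem_stage hρ (k + 1)⟩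
    · exact ⟨d + 2, by rw [stage_of_lt _ (by omega)]; rfl, by rw [stage_of_lt _ (by omega)]; rfl⟩
  · rintro ⟨k, hk, hk'⟩
    by_cases hkd : k ≤ d + 1
    · left
      choose g hg using Ω.stage_nonempty
      obtain ⟨ρ, hρ, h⟩ := Ω.exists_instance_of_stages
        (Function.update (Function.update g k n) (k + 1) n') (fun j => by
        rcases eq_or_ne j (k + 1) with rfl | hj
        · rwa [Function.update_self]
        · rw [Function.update_of_ne hj]
          rcases eq_or_ne j k with rfl | hj
          · rwa [Function.update_self]
          · rw [Function.update_of_ne hj]; exact hg j)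
      refine Set.mem_biUnion hρ ((ρ.mem_graph_edges n n').2 ⟨k, hkd, ?_, ?_⟩)
      · rw [h, Function.update_of_ne (by omega), Function.update_self]
      · rw [h, Function.update_self]
    · right
      rw [stage_of_lt _ (by omega)] at hk hk'
      exact ⟨hk, hk'⟩

end ImpreciseEvidence

/-! ### Stages of the elements of a time partition -/

namespace TimePartition

variable {C : Type*} {d : ℕ} {Ω : ImpreciseEvidence C d} (Ψ : TimePartition Ω)

/-- The stage of an element of a time partition. -/
def Elem.stage {Ψ : TimePartition Ω} : Ψ.Elem → ℕ
  | .zero => 0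
  | .cell k => k.1 + 1
  | .star => d + 2

/-- A picked cell lies inside the observation set of its own index, and these sets are disjoint, so
merging times never mixes stages. -/
lemma stage_elem {k : ℕ} {n : TimeNode} (hn : n ∈ Ω.stage k) :
    (Ψ.elem n).stage = min k (d + 2) := by
  by_cases hk : k ≤ d + 1
  · rw [Ω.stage_of_le hk] at hn
    obtain ⟨t, ht, rfl⟩ := hn
    cases k with
    | zero =>
      rw [mem_singleton_iff.1 ht, elem, dif_neg]
      · rfl
      · rintro ⟨i, hi⟩
        exact lt_irrefl _ (Ω.time_pos i 0 hi)
    | succ k =>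
      have hki : t ∈ Ω.time ⟨k, by omega⟩ := by
        rwa [ImpreciseEvidence.stageTimes, dif_pos (by omega)] at ht
      have hex : ∃ i, t ∈ Ω.time i := ⟨_, hki⟩
      rw [elem, dif_pos hex, Elem.stage]
      have hp : t ∈ Ω.time (Ψ.pick t hex).1 := by
        rw [← Ψ.cover]
        exact mem_iUnion_of_mem _ (Ψ.mem_pick t hex)
      rcases lt_trichotomy (Ψ.pick t hex).1 ⟨k, by omega⟩ with h | h | h
      · exact absurd (Ω.ordered _ _ h _ hp _ hki) (lt_irrefl t)
      · rw [h, min_eq_left (by omega)]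
      · exact absurd (Ω.ordered _ _ h _ hki _ hp) (lt_irrefl t)
  · rw [Ω.stage_of_lt (by omega)] at hn
    rw [mem_singleton_iff.1 hn, min_eq_right (by omega)]
    rfl

lemma min_eq_of_elem_eq {j k : ℕ} {n n' : TimeNode} (hn : n ∈ Ω.stage j) (hn' : n' ∈ Ω.stage k)
    (h : Ψ.elem n = Ψ.elem n') : min j (d + 2) = min k (d + 2) := by
  rw [← Ψ.stage_elem hn, ← Ψ.stage_elem hn', h]

end TimePartition

/-! ### The abstraction, stage by stage -/

namespace CTMC

variable {S C : Type*} [Fintype S] (K : CTMC S C)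
  {d : ℕ} {Ω : ImpreciseEvidence C d}

lemma mem_resetStates {k : ℕ} {n : Ω.graph.nodes} (hn : (n : TimeNode) ∈ Ω.stage k) (s : S) :
    (s, n) ∈ K.resetStates Ω ↔ ¬ K.agrees Ω.label k s := by
  constructor
  · rintro ⟨i, t, ht, h, hs⟩ hag
    change (n : TimeNode) = _ at h
    by_cases hk : k ≤ d + 1
    · rw [h, Ω.stage_of_le hk] at hn
      obtain ⟨t', ht', heq⟩ := hn
      obtain rfl := TimeNode.time.inj heq
      rw [← Ω.stageTimes_succ] at ht
      have hki : k = i + 1 := by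
        rcases lt_trichotomy k (i + 1) with h | h | h
        · exact absurd (Ω.stageTimes_lt h ht' ht) (lt_irrefl _)
        · exact h
        · exact absurd (Ω.stageTimes_lt h ht ht') (lt_irrefl _)
      subst hki
      exact hs (hag i.2)
    · rw [h, Ω.stage_of_lt (by omega)] at hn
      cases hn
  · intro h
    cases k with
    | zero => exact absurd trivial h
    | succ k =>
      rw [agrees, not_forall] at h
      obtain ⟨hk, hs⟩ := h
      rw [Ω.stage_of_le (by omega), Ω.stageTimes_succ ⟨k, hk⟩] at hn
      obtain ⟨t, ht, htn⟩ := hn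
      exact ⟨⟨k, hk⟩, t, ht, htn.symm, hs⟩

variable [DecidableEq S]

lemma mem_conditioned_enabled (q : S × Ω.graph.nodes) (t' : Ω.graph.nodes) :
    t' ∈ (K.conditioned Ω).enabled q
      ↔ ∃ k, (q.2 : TimeNode) ∈ Ω.stage k ∧ (t' : TimeNode) ∈ Ω.stage (k + 1) :=
  Ω.mem_graph_edges_or q.2 t'

variable (Ψ : TimePartition Ω)

/-- The distribution over abstract states of one concrete transition. -/
noncomputable def liftedProb (s : S) (t t' : Ω.graph.nodes) : PMF (S × Ψ.AbsTime) :=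
  ((K.conditioned Ω).prob (s, t) t').map (Prod.map id Ψ.absTime)

lemma liftedProb_of_not_agrees {k : ℕ} {s : S} (hs : ¬ K.agrees Ω.label k s)
    {t t' : Ω.graph.nodes} (ht : (t : TimeNode) ∈ Ω.stage k) :
    K.liftedProb Ψ s t t' = PMF.pure (K.abstraction Ψ).init := by
  rw [liftedProb, conditioned]
  simp only
  rw [if_pos ((K.mem_resetStates ht s).2 hs), PMF.pure_map]
  rfl

lemma liftedProb_of_agrees {k : ℕ} {s : S} (hs : K.agrees Ω.label k s)
    {t t' : Ω.graph.nodes} (ht : (t : TimeNode) ∈ Ω.stage k) :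
    K.liftedProb Ψ s t t' = (K.step s t t').map fun s' => (s', Ψ.absTime t') := by
  rw [liftedProb, conditioned]
  simp only
  rw [if_neg (fun h => (K.mem_resetStates ht s).1 h hs), unfold]
  simp only
  rw [PMF.map_comp]
  rfl

lemma liftedProb_of_last {k : ℕ} (hk : d + 1 ≤ k) {s : S} (hs : K.agrees Ω.label k s)
    {t t' : Ω.graph.nodes} (ht : (t : TimeNode) ∈ Ω.stage k)
    (ht' : (t' : TimeNode) ∈ Ω.stage (k + 1)) :
    K.liftedProb Ψ s t t' = PMF.pure (s, Ψ.absTime t') := by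
  rw [Ω.stage_of_lt (by omega)] at ht'
  rw [K.liftedProb_of_agrees Ψ hs ht, mem_singleton_iff.1 ht', step, PMF.pure_map]

/-- A concrete transition has a single target node, so merging target times adds no two
probabilities together: the lifted entries are plain transient probabilities. -/
lemma liftedProb_apply {k : ℕ} (hk : k ≤ d) {s : S} (hs : K.agrees Ω.label k s)
    {t t' : Ω.graph.nodes} (ht : (t : TimeNode) ∈ Ω.stage k)
    (ht' : (t' : TimeNode) ∈ Ω.stage (k + 1)) :
    ∃ u ∈ Ω.stageTimes k, ∃ u' ∈ Ω.stageTimes (k + 1), (t : TimeNode) = TimeNode.time u ∧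
      (t' : TimeNode) = TimeNode.time u' ∧
      (∀ s', (K.liftedProb Ψ s t t' (s', Ψ.absTime t')).toReal = K.transientMatrix (u' - u) s s') ∧
      ∀ s' c, c ≠ Ψ.absTime t' → K.liftedProb Ψ s t t' (s', c) = 0 := by
  rw [K.liftedProb_of_agrees Ψ hs ht]
  rw [Ω.stage_of_le (by omega)] at ht ht'
  obtain ⟨u, hu, hut⟩ := ht
  obtain ⟨u', hu', hut'⟩ := ht'
  refine ⟨u, hu, u', hu', hut.symm, hut'.symm, fun s' => ?_, fun s' c hc => ?_⟩
  · rw [← hut, ← hut', step, PMF.map_apply, tsum_eq_single s']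
    · rw [if_pos rfl, transient_toReal]
    · intro v hv
      exact if_neg fun h => hv (Prod.mk.inj h).1.symm
  · rw [PMF.map_apply, ENNReal.tsum_eq_zero]
    exact fun v => if_neg fun h => hc (Prod.mk.inj h).2

lemma mem_abstraction_enabled (q : S × Ψ.AbsTime) (b : Ψ.AbsTime) :
    b ∈ (K.abstraction Ψ).enabled q ↔ ∃ (k : ℕ) (t t' : Ω.graph.nodes),
      (t : TimeNode) ∈ Ω.stage k ∧ (t' : TimeNode) ∈ Ω.stage (k + 1) ∧ Ψ.absTime t = q.2 ∧
      Ψ.absTime t' = b := by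
  constructor
  · rintro ⟨t, t', h1, h2, h3⟩
    obtain ⟨k, hk, hk'⟩ := (K.mem_conditioned_enabled _ _).1 h2
    exact ⟨k, t, t', hk, hk', h1, h3⟩
  · rintro ⟨k, t, t', hk, hk', h1, h3⟩
    exact ⟨t, t', h1, (K.mem_conditioned_enabled _ _).2 ⟨k, hk, hk'⟩, h3⟩

/-- The concrete transitions that are merged into one abstract transition. -/
def concreteSteps (s : S) (b b' : Ψ.AbsTime) : Set (Ω.graph.nodes × Ω.graph.nodes) :=
  {p | Ψ.absTime p.1 = b ∧ p.2 ∈ (K.conditioned Ω).enabled (s, p.1) ∧ Ψ.absTime p.2 = b'}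

/-- Since an element determines its stage up to truncation, all transitions merged into one abstract
transition join the same two consecutive stages. -/
lemma concreteSteps_stage {k : ℕ} {n : Ω.graph.nodes} (hn : (n : TimeNode) ∈ Ω.stage k)
    {s : S} {b' : Ψ.AbsTime} {p : Ω.graph.nodes × Ω.graph.nodes}
    (hp : p ∈ K.concreteSteps Ψ s (Ψ.absTime n) b') :
    (p.1 : TimeNode) ∈ Ω.stage k ∧ (p.2 : TimeNode) ∈ Ω.stage (k + 1) := by
  obtain ⟨h1, h2, h3⟩ := hp
  obtain ⟨j, hj, hj'⟩ := (K.mem_conditioned_enabled _ _).1 h2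
  have hmin := Ψ.min_eq_of_elem_eq hj hn (congrArg Subtype.val h1)
  exact ⟨Ω.stage_eq_of_min_eq hmin ▸ hj,
    Ω.stage_eq_of_min_eq (by omega : min (j + 1) (d + 2) = min (k + 1) (d + 2)) ▸ hj'⟩

lemma abstraction_interval (s : S) (b b' : Ψ.AbsTime) (q' : S × Ψ.AbsTime) :
    (K.abstraction Ψ).interval (s, b) b' q'
      = Icc (sInf ((fun p => (K.liftedProb Ψ s p.1 p.2 q').toReal) '' K.concreteSteps Ψ s b b'))
        (sSup ((fun p => (K.liftedProb Ψ s p.1 p.2 q').toReal) '' K.concreteSteps Ψ s b b')) := by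
  have : {x : ℝ | ∃ t t', Ψ.absTime t = b ∧ t' ∈ (K.conditioned Ω).enabled (s, t)
      ∧ Ψ.absTime t' = b' ∧
      x = (((K.conditioned Ω).prob (s, t) t').map (Prod.map id Ψ.absTime) q').toReal}
      = (fun p => (K.liftedProb Ψ s p.1 p.2 q').toReal) '' K.concreteSteps Ψ s b b' := by
    ext x
    constructor
    · rintro ⟨t, t', h1, h2, h3, rfl⟩
      exact ⟨(t, t'), ⟨h1, h2, h3⟩, rfl⟩
    · rintro ⟨⟨t, t'⟩, ⟨h1, h2, h3⟩, rfl⟩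
      exact ⟨t, t', h1, h2, h3, rfl⟩
  rw [← this]
  rfl

lemma concreteSteps_nonempty {s : S} {b b' : Ψ.AbsTime}
    (h : b' ∈ (K.abstraction Ψ).enabled (s, b)) : (K.concreteSteps Ψ s b b').Nonempty := by
  obtain ⟨t, t', h1, h2, h3⟩ := h
  exact ⟨(t, t'), h1, h2, h3⟩

/-- Bounds on the concrete probabilities carry over to admissible transition functions. -/
lemma admissible_mem_Icc {P : S × Ψ.AbsTime → Ψ.AbsTime → PMF (S × Ψ.AbsTime)}
    (hP : P ∈ (K.abstraction Ψ).admissible) {s : S} {b b' : Ψ.AbsTime}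
    (h : b' ∈ (K.abstraction Ψ).enabled (s, b)) {q' : S × Ψ.AbsTime} {x y : ℝ}
    (hxy : ∀ p ∈ K.concreteSteps Ψ s b b', (K.liftedProb Ψ s p.1 p.2 q').toReal ∈ Icc x y) :
    (P (s, b) b' q').toReal ∈ Icc x y := by
  have h1 := hP (s, b) b' h q'
  rw [abstraction_interval] at h1
  have hne := (K.concreteSteps_nonempty Ψ h).image
    (fun p => (K.liftedProb Ψ s p.1 p.2 q').toReal)
  refine ⟨(le_csInf hne ?_).trans h1.1, h1.2.trans (csSup_le hne ?_)⟩
  · rintro _ ⟨p, hp, rfl⟩; exact (hxy p hp).1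
  · rintro _ ⟨p, hp, rfl⟩; exact (hxy p hp).2

/-- All intervals of such a row are single points. -/
lemma admissible_eq_of_const {P : S × Ψ.AbsTime → Ψ.AbsTime → PMF (S × Ψ.AbsTime)}
    (hP : P ∈ (K.abstraction Ψ).admissible) {s : S} {b b' : Ψ.AbsTime}
    (h : b' ∈ (K.abstraction Ψ).enabled (s, b)) {μ : PMF (S × Ψ.AbsTime)}
    (hμ : ∀ p ∈ K.concreteSteps Ψ s b b', K.liftedProb Ψ s p.1 p.2 = μ) : P (s, b) b' = μ := by
  ext q'
  have := K.admissible_mem_Icc Ψ hP h (q' := q') (x := (μ q').toReal) (y := (μ q').toReal)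
    fun p hp => by rw [hμ p hp]; exact ⟨le_rfl, le_rfl⟩
  exact (ENNReal.toReal_eq_toReal_iff' (PMF.apply_ne_top _ _) (PMF.apply_ne_top _ _)).1
    (le_antisymm this.2 this.1)

lemma mem_admissible_of_concrete {P : S × Ψ.AbsTime → Ψ.AbsTime → PMF (S × Ψ.AbsTime)}
    (hP : ∀ s b b', b' ∈ (K.abstraction Ψ).enabled (s, b) →
      ∃ p ∈ K.concreteSteps Ψ s b b', P (s, b) b' = K.liftedProb Ψ s p.1 p.2) :
    P ∈ (K.abstraction Ψ).admissible := by
  rintro ⟨s, b⟩ b' h q'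
  obtain ⟨p, hp, heq⟩ := hP s b b' h
  rw [abstraction_interval, heq]
  have hle : ∀ p : Ω.graph.nodes × Ω.graph.nodes, (K.liftedProb Ψ s p.1 p.2 q').toReal ≤ 1 :=
    fun p => ENNReal.toReal_le_of_le_ofReal zero_le_one (by simpa using PMF.coe_le_one _ _)
  -- Infimum and supremum are taken in `ℝ`, so the bounds 0 and 1 on probabilities are needed here.
  refine ⟨csInf_le ⟨0, ?_⟩ ⟨p, hp, rfl⟩, le_csSup ⟨1, ?_⟩ ⟨p, hp, rfl⟩⟩
  · rintro _ ⟨p, _, rfl⟩; exact ENNReal.toReal_nonneg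
  · rintro _ ⟨p, _, rfl⟩; exact hle p

end CTMC

/-! ### Support of the transient distributions -/

namespace CTMC

section Support

variable {S C : Type*} [Fintype S] [DecidableEq S] (K : CTMC S C)

lemma continuous_transientMatrix (s s' : S) :
    Continuous fun t : ℝ≥0 => K.transientMatrix t s s' := by
  let : NormedRing (Matrix S S ℝ) := Matrix.linftyOpNormedRing
  let : NormedAlgebra ℝ (Matrix S S ℝ) := Matrix.linftyOpNormedAlgebra
  let : NormedAlgebra ℚ (Matrix S S ℝ) := NormedAlgebra.restrictScalars ℚ ℝ _
  have h : Continuous fun t : ℝ≥0 => NormedSpace.exp ((t : ℝ) • K.generator) :=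
    (NormedSpace.exp_continuous (𝔸 := Matrix S S ℝ)).comp
      (NNReal.continuous_coe.smul continuous_const)
  exact h.matrix_elem s s'

lemma matrix_pow_nonneg {A : Matrix S S ℝ} (hA : ∀ s s', 0 ≤ A s s') (n : ℕ) (s s' : S) :
    0 ≤ (A ^ n) s s' := by
  induction n generalizing s with
  | zero => rw [pow_zero, Matrix.one_apply]; split_ifs <;> norm_num
  | succ n ih =>
    rw [pow_succ', Matrix.mul_apply]
    exact Finset.sum_nonneg fun j _ => mul_nonneg (hA s j) (ih j)

/-- At positive times the support of the transient distribution does not depend on the time. -/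
lemma transientMatrix_eq_zero {t u : ℝ≥0} (ht : 0 < t) {s s' : S}
    (h : K.transientMatrix t s s' = 0) : K.transientMatrix u s s' = 0 := by
  -- Uniformisation: the total rate dominates each exit rate, so shifting the diagonal by `c` makes
  -- the generator entrywise nonnegative, at the cost of a positive scalar factor in the
  -- exponential.
  set c : ℝ := ∑ s, (K.rate s : ℝ) with hc
  set B : Matrix S S ℝ := K.generator + Matrix.diagonal (fun _ => c) with hB
  have hBnn : ∀ i j, 0 ≤ B i j := by
    intro i j
    have h1 : 0 ≤ K.trans i j * (K.rate i : ℝ) := mul_nonneg (K.trans_nonneg i j) (K.rate i).2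
    by_cases h : i = j
    · subst h
      have h2 : (K.rate i : ℝ) ≤ c :=
        Finset.single_le_sum (f := fun s => (K.rate s : ℝ)) (fun s _ => (K.rate s).2)
          (Finset.mem_univ i)
      simp only [hB, generator, rateMatrix, Matrix.add_apply, Matrix.sub_apply, Matrix.of_apply,
        Matrix.diagonal_apply_eq]
      linarith
    · simpa [hB, generator, rateMatrix, Matrix.diagonal_apply_ne _ h] using h1
  have hfac : ∀ v : ℝ≥0, K.transientMatrix v s s'
      = Real.exp (-(v * c)) * NormedSpace.exp ((v : ℝ) • B) s s' := by
    intro v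
    have hE : (v : ℝ) • K.generator = Matrix.diagonal (fun _ => -(v * c)) + (v : ℝ) • B := by
      ext i j
      by_cases h : i = j
      · subst h; simp [hB]
      · simp [hB, Matrix.diagonal_apply_ne _ h]
    have hcomm : Commute (Matrix.diagonal (fun _ : S => -((v : ℝ) * c))) ((v : ℝ) • B) := by
      have : (Matrix.diagonal (fun _ : S => -((v : ℝ) * c)))
          = algebraMap ℝ (Matrix S S ℝ) (-(v * c)) := by
        rw [Matrix.algebraMap_eq_diagonal]; rfl
      rw [this]
      exact Algebra.commutes _ _
    rw [transientMatrix, hE, Matrix.exp_add_of_commute _ _ hcomm, Matrix.exp_diagonal,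
      Matrix.diagonal_mul, Pi.coe_exp, ← Real.exp_eq_exp_ℝ]
  have hsum : ∀ v : ℝ≥0, HasSum (fun n : ℕ => ((n.factorial : ℝ)⁻¹ * (v : ℝ) ^ n) * (B ^ n) s s')
      (NormedSpace.exp ((v : ℝ) • B) s s') := by
    intro v
    have := hasSum_exp_apply ((v : ℝ) • B) s s'
    simpa only [smul_pow, Matrix.smul_apply, smul_eq_mul, mul_assoc] using this
  have h0 : NormedSpace.exp ((t : ℝ) • B) s s' = 0 := by
    rw [hfac] at h
    exact (mul_eq_zero.1 h).resolve_left (Real.exp_pos _).ne'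
  -- A vanishing series of nonnegative terms at one positive time kills the entry of every power of
  -- `B`, and hence the series at every other time.
  have hz := (hasSum_zero_iff_of_nonneg fun n => mul_nonneg (by positivity)
    (matrix_pow_nonneg hBnn n s s')).1 (h0 ▸ hsum t)
  have hpow : ∀ n, (B ^ n) s s' = 0 := by
    intro n
    have := congrFun hz n
    simp only [Pi.zero_apply] at this
    refine (mul_eq_zero.1 this).resolve_left ?_
    have : (0 : ℝ) < t := ht
    positivity
  have hu := hsum u
  simp only [hpow, mul_zero] at hu
  rw [hfac, hu.unique hasSum_zero, mul_zero]

end Support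

/-! ### The value of a consistent scheduler -/

/-- The expected weight after `n` stages of filtering, given that all observations agree. -/
noncomputable def filterValue {S C : Type*} [Fintype S] [DecidableEq S] (K : CTMC S C) (w : S → ℝ≥0)
    {d : ℕ} (o : Fin (d + 1) → C) (A : ℕ → S → S → ℝ) : ℝ :=
  ∑ s, forwardMass A (K.agrees o) K.init (d + 1) s
    / (∑ s', forwardMass A (K.agrees o) K.init (d + 1) s') * (w s : ℝ)

end CTMC

/-- The node of a stage of an instance, as a node of the graph of the imprecise evidence. -/
def ImpreciseEvidence.instanceNode {C : Type*} {d : ℕ} (Ω : ImpreciseEvidence C d)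
    (ρ : Ω.instances) (k : ℕ) : Ω.graph.nodes :=
  ⟨ρ.1.stageNode k, (Ω.mem_graph_nodes _).2 ⟨k, Ω.stageNode_mem_stage ρ.2 k⟩⟩

/-! ### Admissible transition functions along an instance -/

namespace CTMC

variable {S C : Type*} [Fintype S] [DecidableEq S] (K : CTMC S C)
  {d : ℕ} {Ω : ImpreciseEvidence C d} (Ψ : TimePartition Ω) (ρ : Ω.instances)

/-- The scheduler visits the elements of the time partition that contain the times of the
instance. -/
def Follows (σ : S × Ψ.AbsTime → Ψ.AbsTime) : Prop :=
  ∀ s k, σ (s, Ψ.absTime (Ω.instanceNode ρ k)) = Ψ.absTime (Ω.instanceNode ρ (k + 1))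

/-- The one-step weights along the elements of the time partition visited by an instance. -/
noncomputable def alongInstance (p : S × Ψ.AbsTime → Ψ.AbsTime → S × Ψ.AbsTime → ℝ)
    (k : ℕ) (s s' : S) : ℝ :=
  p (s, Ψ.absTime (Ω.instanceNode ρ k)) (Ψ.absTime (Ω.instanceNode ρ (k + 1)))
    (s', Ψ.absTime (Ω.instanceNode ρ (k + 1)))

variable {Ψ} {ρ}

lemma instanceNode_mem (k : ℕ) : (Ω.instanceNode ρ k : TimeNode) ∈ Ω.stage k :=
  Ω.stageNode_mem_stage ρ.2 k

/-- Different stages of an instance never share an element, apart from the repeated terminal one.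
This makes the sequence of visited elements layered. -/
lemma absTime_instanceNode_min {j k : ℕ}
    (h : Ψ.absTime (Ω.instanceNode ρ j) = Ψ.absTime (Ω.instanceNode ρ k)) :
    min j (d + 2) = min k (d + 2) :=
  Ψ.min_eq_of_elem_eq (instanceNode_mem j) (instanceNode_mem k) (congrArg Subtype.val h)

lemma instanceNode_enabled (s : S) (k : ℕ) :
    Ψ.absTime (Ω.instanceNode ρ (k + 1))
      ∈ (K.abstraction Ψ).enabled (s, Ψ.absTime (Ω.instanceNode ρ k)) :=
  (K.mem_abstraction_enabled Ψ _ _).2 ⟨k, _, _, instanceNode_mem k, instanceNode_mem (k + 1),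
    rfl, rfl⟩

lemma instanceNode_eq_of_min_eq {j k : ℕ} (h : min j (d + 2) = min k (d + 2)) :
    Ω.instanceNode ρ j = Ω.instanceNode ρ k := by
  by_cases hj : j ≤ d + 1
  · rw [show j = k by omega]
  · refine Subtype.ext ?_
    change ρ.1.stageNode j = ρ.1.stageNode k
    rw [ρ.1.stageNode_of_lt (by omega), ρ.1.stageNode_of_lt (by omega)]

section Value

variable {P : S × Ψ.AbsTime → Ψ.AbsTime → PMF (S × Ψ.AbsTime)}

lemma admissible_of_not_agrees (hP : P ∈ (K.abstraction Ψ).admissible)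
    {k : ℕ} {s : S} (hs : ¬ K.agrees Ω.label k s) :
    P (s, Ψ.absTime (Ω.instanceNode ρ k)) (Ψ.absTime (Ω.instanceNode ρ (k + 1)))
      = PMF.pure (K.abstraction Ψ).init :=
  K.admissible_eq_of_const Ψ hP (K.instanceNode_enabled s k) fun _ hp =>
    K.liftedProb_of_not_agrees Ψ hs (K.concreteSteps_stage Ψ (instanceNode_mem k) hp).1

lemma admissible_of_last (hP : P ∈ (K.abstraction Ψ).admissible)
    {k : ℕ} (hk : d + 1 ≤ k) {s : S} (hs : K.agrees Ω.label k s) :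
    P (s, Ψ.absTime (Ω.instanceNode ρ k)) (Ψ.absTime (Ω.instanceNode ρ (k + 1)))
      = PMF.pure (s, Ψ.absTime (Ω.instanceNode ρ (k + 1))) := by
  refine K.admissible_eq_of_const Ψ hP (K.instanceNode_enabled s k) fun p hp => ?_
  have h := K.concreteSteps_stage Ψ (instanceNode_mem k) hp
  rw [K.liftedProb_of_last Ψ hk hs h.1 h.2, hp.2.2]

/-- No merged transition puts mass outside the chosen element, so the interval there is the single
point 0. -/
lemma admissible_other (hP : P ∈ (K.abstraction Ψ).admissible)
    {k : ℕ} (hk : k ≤ d) {s : S} (hs : K.agrees Ω.label k s) (s' : S)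
    {c : Ψ.AbsTime} (hc : c ≠ Ψ.absTime (Ω.instanceNode ρ (k + 1))) :
    (P (s, Ψ.absTime (Ω.instanceNode ρ k)) (Ψ.absTime (Ω.instanceNode ρ (k + 1))) (s', c)).toReal
      = 0 := by
  have := K.admissible_mem_Icc Ψ hP (K.instanceNode_enabled s k) (q' := (s', c)) (x := 0) (y := 0)
    fun p hp => by
      have h := K.concreteSteps_stage Ψ (instanceNode_mem k) hp
      obtain ⟨_, _, _, _, _, _, _, h0⟩ := K.liftedProb_apply Ψ hk hs h.1 h.2
      rw [h0 s' c (hp.2.2 ▸ hc)]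
      simp
  exact le_antisymm this.2 this.1

/-- The support of an admissible transition function is that of the concrete instance. -/
lemma admissible_support (hP : P ∈ (K.abstraction Ψ).admissible)
    {k : ℕ} (hk : k ≤ d) {s : S} (hs : K.agrees Ω.label k s) (s' : S) :
    alongInstance Ψ ρ (fun q a q' => (P q a q').toReal) k s s' = 0
      ↔ K.transientMatrix (ρ.1.stageTime (k + 1) - ρ.1.stageTime k) s s' = 0 := by
  have hpos : 0 < ρ.1.stageTime (k + 1) - ρ.1.stageTime k :=
    tsub_pos_of_lt (ρ.1.stageTime_lt k (k + 1) (by omega) (by omega))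
  have hval : ∀ p ∈ K.concreteSteps Ψ s (Ψ.absTime (Ω.instanceNode ρ k))
      (Ψ.absTime (Ω.instanceNode ρ (k + 1))), ∃ u ∈ Ω.stageTimes k, ∃ u' ∈ Ω.stageTimes (k + 1),
      (K.liftedProb Ψ s p.1 p.2 (s', Ψ.absTime (Ω.instanceNode ρ (k + 1)))).toReal
        = K.transientMatrix (u' - u) s s' := by
    intro p hp
    have h := K.concreteSteps_stage Ψ (instanceNode_mem k) hp
    obtain ⟨u, hu, u', hu', _, _, h1, _⟩ := K.liftedProb_apply Ψ hk hs h.1 h.2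
    exact ⟨u, hu, u', hu', by rw [← h1, hp.2.2]⟩
  have hen := K.instanceNode_enabled (Ψ := Ψ) (ρ := ρ) s k
  constructor
  · intro h
    by_contra hne
    have hpos' : ∀ u ∈ Ω.stageTimes k, ∀ u' ∈ Ω.stageTimes (k + 1),
        0 < K.transientMatrix (u' - u) s s' := by
      intro u hu u' hu'
      refine (K.transientMatrix_nonneg _ _ _).lt_of_ne' fun h0 => hne ?_
      exact K.transientMatrix_eq_zero (tsub_pos_of_lt (Ω.stageTimes_lt (by omega) hu hu')) h0
    obtain ⟨p, hp⟩ := K.concreteSteps_nonempty Ψ hen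
    obtain ⟨u, hu, u', hu', _⟩ := hval p hp
    -- Pointwise positivity alone would allow the infimum 0; by continuity and compactness the least
    -- probability over all pairs of times is attained, so the lower end of the interval is
    -- positive.
    obtain ⟨x, hx, hmin⟩ := ((Ω.isCompact_stageTimes k).prod
      (Ω.isCompact_stageTimes (k + 1))).exists_isMinOn ⟨(u, u'), hu, hu'⟩
      (f := fun x : ℝ≥0 × ℝ≥0 => K.transientMatrix (x.2 - x.1) s s')
      ((K.continuous_transientMatrix s s').comp
        (continuous_snd.sub continuous_fst)).continuousOn
    have hb := K.admissible_mem_Icc Ψ hP hen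
      (q' := (s', Ψ.absTime (Ω.instanceNode ρ (k + 1))))
      (x := K.transientMatrix (x.2 - x.1) s s') (y := 1) fun p hp => by
        obtain ⟨v, hv, v', hv', heq⟩ := hval p hp
        refine ⟨?_, ENNReal.toReal_le_of_le_ofReal zero_le_one (by simpa using PMF.coe_le_one _ _)⟩
        rw [heq]
        exact isMinOn_iff.1 hmin (v, v') ⟨hv, hv'⟩
    have := hpos' x.1 hx.1 x.2 hx.2
    exact absurd h (lt_of_lt_of_le this hb.1).ne'
  · intro h
    have hb := K.admissible_mem_Icc Ψ hP hen
      (q' := (s', Ψ.absTime (Ω.instanceNode ρ (k + 1)))) (x := 0) (y := 0) fun p hp => by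
        obtain ⟨v, hv, v', hv', heq⟩ := hval p hp
        rw [heq, K.transientMatrix_eq_zero hpos h]
        exact ⟨le_rfl, le_rfl⟩
    exact le_antisymm hb.2 hb.1

variable [MeasurableSpace S] [MeasurableSingletonClass S]

/-- An instance of `reachProb_layered` whose last accepting stage is `d + 1`: resets and absorption
are forced by degenerate intervals, and only the rows between stages are free. -/
lemma abstractWeight_eq_filterValue (hP : P ∈ (K.abstraction Ψ).admissible)
    (w : S → ℝ≥0) {σ : S × Ψ.AbsTime → Ψ.AbsTime}
    (hσ : Follows Ψ ρ σ) :
    K.abstractWeight w Ψ P σ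
      = K.filterValue w Ω.label (alongInstance Ψ ρ fun q a q' => (P q a q').toReal) := by
  classical
  have : Fintype Ψ.AbsTime := Fintype.ofFinite _
  have hinit : (K.abstraction Ψ).init = (K.init, Ψ.absTime (Ω.instanceNode ρ 0)) := by
    refine Prod.ext rfl (Subtype.ext ?_)
    change Ψ.elem (TimeNode.time 0) = Ψ.elem (ρ.1.stageNode 0)
    rw [Evidence.stageNode_zero]
  have hstar : Ψ.absStar = Ψ.absTime (Ω.instanceNode ρ (d + 1 + 1)) := by
    refine Subtype.ext ?_
    change Ψ.elem TimeNode.star = Ψ.elem (ρ.1.stageNode (d + 1 + 1))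
    rw [Evidence.stageNode_of_lt _ (by omega)]
  have hreach : ∀ s, (K.abstraction Ψ).reach P σ (s, Ψ.absStar)
      = forwardMass (alongInstance Ψ ρ fun q a q' => (P q a q').toReal) (K.agrees Ω.label) K.init
          (d + 1) s / ∑ s', forwardMass (alongInstance Ψ ρ fun q a q' => (P q a q').toReal)
          (K.agrees Ω.label) K.init (d + 1) s' := fun s => by
    rw [IMDP.reach, hinit, hstar]
    exact reachProb_layered (fun q => P q (σ q))
      (fun k s => (s, Ψ.absTime (Ω.instanceNode ρ k))) (K.agrees Ω.label) K.init (d + 1)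
      (alongInstance Ψ ρ fun q a q' => (P q a q').toReal) trivial
      (by
        intro k hk s hs φ
        simp only [chainMatrix, Matrix.of_apply]
        rw [hσ s k, Fintype.sum_prod_type]
        refine Finset.sum_congr rfl fun s' _ => ?_
        rw [Finset.sum_eq_single (Ψ.absTime (Ω.instanceNode ρ (k + 1)))]
        · rfl
        · intro c _ hc
          rw [K.admissible_other hP (by omega) hs s' hc, zero_mul]
        · simp)
      (by
        intro k hk s hs
        rw [hσ s k, K.admissible_of_not_agrees hP hs, hinit])
      (by
        intro s hs
        rw [hσ s, K.admissible_of_last hP le_rfl hs])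
      (by
        intro s
        -- No observation belongs to the terminal stage, so agreement is vacuous; the stage after it
        -- is the same terminal node, which makes the state absorbing.
        have hag : K.agrees Ω.label (d + 1 + 1) s := fun h => absurd h (by omega)
        rw [hσ s, K.admissible_of_last hP (by omega) hag,
          instanceNode_eq_of_min_eq
            (by omega : min (d + 1 + 1 + 1) (d + 2) = min (d + 1 + 1) (d + 2))])
      (by
        intro k hk s s' h
        have := absTime_instanceNode_min (Prod.mk.inj h).2
        omega)
      (fun s s' h => (Prod.mk.inj h).1)
      (fun k _ s s' => ENNReal.toReal_nonneg) s
  simp only [abstractWeight, filterValue, hreach]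

end Value

end CTMC

/-! ### Continuity and compactness -/

lemma continuous_forwardMass {X S : Type*} [TopologicalSpace X] [Fintype S] [DecidableEq S]
    {A : X → ℕ → S → S → ℝ} (hA : ∀ k s s', Continuous fun x => A x k s s') (ok : ℕ → S → Prop)
    (s₀ : S) (k : ℕ) (s : S) : Continuous fun x => forwardMass (A x) ok s₀ k s := by
  induction k generalizing s with
  | zero => simp only [forwardMass]; exact continuous_const
  | succ k ih =>
    simp only [forwardMass]
    split_ifs
    · exact continuous_finsetSum _ fun v _ => (ih v).mul (hA k v s)
    · exact continuous_const

/-- The admissible transition functions of a finite interval MDP, as arrays of real numbers, form a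
compact set. -/
lemma IMDP.isCompact_admissible {Q A : Type*} [Finite Q] (I : IMDP Q A)
    (hI : ∀ q a q', IsClosed (I.interval q a q')) :
    IsCompact ((fun (P : Q → A → PMF Q) q a q' => (P q a q').toReal) '' I.admissible) := by
  have := Fintype.ofFinite Q
  -- The arrays form a closed subset of a product of unit intervals. Rows of actions that are not
  -- enabled are still distributions, so the row sums are imposed everywhere and the intervals only
  -- at enabled actions.
  have hset : (fun (P : Q → A → PMF Q) q a q' => (P q a q').toReal) '' I.admissible
      = (Set.pi univ fun _ => Set.pi univ fun _ => Set.pi univ fun _ => Icc (0 : ℝ) 1)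
        ∩ ((⋂ q, ⋂ a, {p : Q → A → Q → ℝ | ∑ q', p q a q' = 1})
        ∩ ⋂ q, ⋂ a, ⋂ (_ : a ∈ I.enabled q), ⋂ q',
          {p : Q → A → Q → ℝ | p q a q' ∈ I.interval q a q'}) := by
    ext p
    constructor
    · rintro ⟨P, hP, rfl⟩
      refine ⟨?_, ?_, ?_⟩
      · exact fun q _ a _ q' _ => ⟨ENNReal.toReal_nonneg,
          ENNReal.toReal_le_of_le_ofReal zero_le_one (by simpa using PMF.coe_le_one _ _)⟩
      · simp only [mem_iInter, mem_ofPred_eq]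
        exact fun q a => chainMatrix_sum (fun q => P q a) q
      · simp only [mem_iInter, mem_ofPred_eq]
        exact hP
    · rintro ⟨h1, h2, h3⟩
      simp only [mem_iInter, mem_ofPred_eq] at h2 h3
      have hnn : ∀ q a q', 0 ≤ p q a q' := fun q a q' =>
        (h1 q trivial a trivial q' trivial).1
      have heq : (fun q a q' => ((PMF.ofFintype (fun q' => ENNReal.ofReal (p q a q')) (by
          rw [← ENNReal.ofReal_sum_of_nonneg fun q' _ => hnn q a q', h2, ENNReal.ofReal_one])
            : PMF Q) q').toReal) = p := by
        funext q a q'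
        exact ENNReal.toReal_ofReal (hnn q a q')
      refine ⟨_, ?_, heq⟩
      intro q a ha q'
      have := h3 q a ha q'
      rwa [← heq] at this
  rw [hset]
  refine (isCompact_univ_pi fun _ => isCompact_univ_pi fun _ => isCompact_univ_pi fun _ =>
    isCompact_Icc).inter_right (IsClosed.inter ?_ ?_)
  · exact isClosed_iInter fun q => isClosed_iInter fun a =>
      isClosed_eq (by fun_prop) continuous_const
  · exact isClosed_iInter fun q => isClosed_iInter fun a => isClosed_iInter fun _ =>
      isClosed_iInter fun q' => (hI q a q').preimage
        (by fun_prop : Continuous fun p : Q → A → Q → ℝ => p q a q')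

/-! ### Correspondence between schedulers and instances -/

namespace CTMC

variable {S C : Type*} [Fintype S] [DecidableEq S] (K : CTMC S C)
  {d : ℕ} {Ω : ImpreciseEvidence C d} (Ψ : TimePartition Ω)

lemma exists_enabled (b : Ψ.AbsTime) :
    ∃ b', ∀ s : S, b' ∈ (K.abstraction Ψ).enabled (s, b) := by
  obtain ⟨_, n, rfl⟩ := b
  obtain ⟨k, hk⟩ := (Ω.mem_graph_nodes _).1 n.2
  obtain ⟨m, hm⟩ := Ω.stage_nonempty (k + 1)
  exact ⟨Ψ.absTime ⟨m, (Ω.mem_graph_nodes m).2 ⟨_, hm⟩⟩, fun s =>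
    (K.mem_abstraction_enabled Ψ _ _).2 ⟨k, n, _, hk, hm, rfl, rfl⟩⟩

lemma exists_scheduler_of_instance (ρ : Ω.instances) :
    ∃ σ ∈ (K.abstraction Ψ).consistentSchedulers, Follows Ψ ρ σ := by
  have h : ∀ b : Ψ.AbsTime, ∃ b', (∀ s : S, b' ∈ (K.abstraction Ψ).enabled (s, b)) ∧
      ∀ k, b = Ψ.absTime (Ω.instanceNode ρ k) → b' = Ψ.absTime (Ω.instanceNode ρ (k + 1)) := by
    intro b
    -- On visited elements the choice is forced, and it is well defined because an element
    -- determines its stage. Elsewhere any enabled action serves.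
    by_cases hb : ∃ k, b = Ψ.absTime (Ω.instanceNode ρ k)
    · obtain ⟨k, rfl⟩ := hb
      refine ⟨Ψ.absTime (Ω.instanceNode ρ (k + 1)), fun s => K.instanceNode_enabled s k,
        fun j hj => ?_⟩
      have := absTime_instanceNode_min hj
      rw [instanceNode_eq_of_min_eq (by omega : min (k + 1) (d + 2) = min (j + 1) (d + 2))]
    · obtain ⟨b', hb'⟩ := K.exists_enabled Ψ b
      exact ⟨b', hb', fun k hk => absurd ⟨k, hk⟩ hb⟩
  choose f hf hf' using h
  exact ⟨fun q => f q.2, ⟨fun q => hf q.2 q.1, fun _ _ _ => rfl⟩, fun s k => hf' _ k rfl⟩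

lemma exists_instance_of_scheduler {σ : S × Ψ.AbsTime → Ψ.AbsTime}
    (hσ : σ ∈ (K.abstraction Ψ).consistentSchedulers) : ∃ ρ : Ω.instances, Follows Ψ ρ σ := by
  -- The sequence of elements the scheduler visits; by consistency it can be read off at the initial
  -- state.
  set b : ℕ → Ψ.AbsTime := fun k => Nat.rec
    (Ψ.absTime ⟨TimeNode.time 0, Ω.graph.zero_mem⟩) (fun _ c => σ (K.init, c)) k with hb
  have h : ∀ k, ∃ n : Ω.graph.nodes, (n : TimeNode) ∈ Ω.stage k ∧ Ψ.absTime n = b k := by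
    intro k
    induction k with
    | zero => exact ⟨_, by rw [Ω.stage_zero]; rfl, rfl⟩
    | succ k ih =>
      obtain ⟨n, hn, hnb⟩ := ih
      have hen := hσ.1 (K.init, b k)
      obtain ⟨t, t', h1, h2, h3⟩ := hen
      rw [← hnb] at h1
      -- The witness `t` that enables the action need not be the node `n` found before; only the
      -- stage of `t'` matters.
      exact ⟨t', (K.concreteSteps_stage Ψ hn (p := (t, t')) ⟨h1, h2, h3⟩).2, h3⟩
  choose f hf hfb using h
  obtain ⟨ρ, hρ, hρf⟩ := Ω.exists_instance_of_stages (fun k => f k) hf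
  have heq : ∀ k, Ω.instanceNode ⟨ρ, hρ⟩ k = f k := fun k => Subtype.ext (hρf k)
  refine ⟨⟨ρ, hρ⟩, fun s k => ?_⟩
  rw [heq, heq, hfb, hfb, hσ.2 s K.init]

lemma exists_admissible_of_instance (ρ : Ω.instances) :
    ∃ P ∈ (K.abstraction Ψ).admissible, ∀ k ≤ d, ∀ s, K.agrees Ω.label k s → ∀ s',
      alongInstance Ψ ρ (fun q a q' => (P q a q').toReal) k s s'
        = K.transientMatrix (ρ.1.stageTime (k + 1) - ρ.1.stageTime k) s s' := by
  -- Each row is copied from one concrete transition: from that of the instance where it passes,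
  -- from an arbitrary merged one at other enabled actions. Rows that are not enabled are arbitrary.
  have h : ∀ (q : S × Ψ.AbsTime) (a : Ψ.AbsTime), ∃ μ : PMF (S × Ψ.AbsTime),
      (a ∈ (K.abstraction Ψ).enabled q →
        ∃ p ∈ K.concreteSteps Ψ q.1 q.2 a, μ = K.liftedProb Ψ q.1 p.1 p.2) ∧
      ∀ k, q.2 = Ψ.absTime (Ω.instanceNode ρ k) → a = Ψ.absTime (Ω.instanceNode ρ (k + 1)) →
        μ = K.liftedProb Ψ q.1 (Ω.instanceNode ρ k) (Ω.instanceNode ρ (k + 1)) := by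
    rintro ⟨s, b⟩ a
    by_cases hk : ∃ k, b = Ψ.absTime (Ω.instanceNode ρ k) ∧ a = Ψ.absTime (Ω.instanceNode ρ (k + 1))
    · obtain ⟨k, rfl, rfl⟩ := hk
      refine ⟨_, fun _ => ⟨(Ω.instanceNode ρ k, Ω.instanceNode ρ (k + 1)), ⟨rfl, ?_, rfl⟩, rfl⟩,
        fun j hj _ => ?_⟩
      · exact (K.mem_conditioned_enabled _ _).2 ⟨k, instanceNode_mem k, instanceNode_mem (k + 1)⟩
      · have hmin := absTime_instanceNode_min hj
        rw [instanceNode_eq_of_min_eq hmin,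
          instanceNode_eq_of_min_eq (by omega : min (k + 1) (d + 2) = min (j + 1) (d + 2))]
    · by_cases ha : a ∈ (K.abstraction Ψ).enabled (s, b)
      · obtain ⟨p, hp⟩ := K.concreteSteps_nonempty Ψ ha
        exact ⟨_, fun _ => ⟨p, hp, rfl⟩, fun k h1 h2 => absurd ⟨k, h1, h2⟩ hk⟩
      · exact ⟨PMF.pure (s, b), fun h => absurd h ha, fun k h1 h2 => absurd ⟨k, h1, h2⟩ hk⟩
  choose P hP hPρ using h
  refine ⟨P, K.mem_admissible_of_concrete Ψ fun s b b' hb => hP (s, b) b' hb, ?_⟩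
  intro k hk s hs s'
  obtain ⟨u, _, u', _, hu, hu', h1, _⟩ := K.liftedProb_apply Ψ hk hs
    (instanceNode_mem (ρ := ρ) k) (instanceNode_mem (ρ := ρ) (k + 1))
  rw [alongInstance, hPρ _ _ k rfl rfl, h1]
  change ρ.1.stageNode k = _ at hu
  change ρ.1.stageNode (k + 1) = _ at hu'
  rw [Evidence.stageNode, if_pos (by omega)] at hu hu'
  rw [TimeNode.time.inj hu, TimeNode.time.inj hu']

variable [MeasurableSpace S]

lemma instanceWeight_le (w : S → ℝ≥0) (ρ : Evidence C d) :
    K.instanceWeight w ρ ≤ ∑ s, (w s : ℝ) :=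
  Finset.sum_le_sum fun s _ => mul_le_of_le_one_left (w s).2
    (div_le_one_of_le₀ (measureReal_mono inter_subset_right) measureReal_nonneg)

variable [MeasurableSingletonClass S]

lemma instanceWeight_eq_filterValue (w : S → ℝ≥0) (ρ : Ω.instances) :
    K.instanceWeight w ρ.1 = K.filterValue w Ω.label
      fun k s s' => K.transientMatrix (ρ.1.stageTime (k + 1) - ρ.1.stageTime k) s s' := by
  rw [K.instanceWeight_eq, ρ.2.1]
  rfl

/-- The soundness of the abstraction: rows copied from the instance are admissible and reproduce its
filtering masses. -/
lemma instanceWeight_mem_image (w : S → ℝ≥0) {ρ : Ω.instances} {σ : S × Ψ.AbsTime → Ψ.AbsTime}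
    (hσ : Follows Ψ ρ σ) :
    K.instanceWeight w ρ.1
      ∈ (fun P => K.abstractWeight w Ψ P σ) '' (K.abstraction Ψ).admissible := by
  obtain ⟨P, hP, hPA⟩ := K.exists_admissible_of_instance Ψ ρ
  refine ⟨P, hP, ?_⟩
  have hfm : ∀ s, forwardMass (alongInstance Ψ ρ fun q a q' => (P q a q').toReal)
      (K.agrees Ω.label) K.init (d + 1) s = _ := fun s =>
    forwardMass_congr (n := d + 1) (ok := K.agrees Ω.label) (s₀ := K.init) trivial
      (fun k hk s hs s' => hPA k (by omega) s hs s') (d + 1) le_rfl s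
  simp only [K.abstractWeight_eq_filterValue hP w hσ, K.instanceWeight_eq_filterValue w ρ,
    filterValue, hfm]

/-- For a fixed consistent scheduler, the value attains its bounds over the admissible transition
functions. -/
lemma exists_isLeast_isGreatest_abstractWeight (w : S → ℝ≥0) {ρ : Ω.instances}
    {σ : S × Ψ.AbsTime → Ψ.AbsTime} (hσ : Follows Ψ ρ σ) :
    (∃ m, IsLeast ((fun P => K.abstractWeight w Ψ P σ) '' (K.abstraction Ψ).admissible) m) ∧
    ∃ M, IsGreatest ((fun P => K.abstractWeight w Ψ P σ) '' (K.abstraction Ψ).admissible) M := by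
  set toArray := fun (P : S × Ψ.AbsTime → Ψ.AbsTime → PMF (S × Ψ.AbsTime)) q a q' =>
    (P q a q').toReal with hΦ
  have himage : (fun P => K.abstractWeight w Ψ P σ) '' (K.abstraction Ψ).admissible
      = (fun p => K.filterValue w Ω.label (alongInstance Ψ ρ p)) ''
        (toArray '' (K.abstraction Ψ).admissible) := by
    rw [image_image]
    exact image_congr fun P hP => K.abstractWeight_eq_filterValue hP w hσ
  have hcompact : IsCompact (toArray '' (K.abstraction Ψ).admissible) :=
    IMDP.isCompact_admissible _ fun q a q' => isClosed_Icc
  have hne : ((fun P => K.abstractWeight w Ψ P σ) '' (K.abstraction Ψ).admissible).Nonempty :=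
    ⟨_, K.instanceWeight_mem_image Ψ w hσ⟩
  have hcont : ∀ s, Continuous fun p : S × Ψ.AbsTime → Ψ.AbsTime → S × Ψ.AbsTime → ℝ =>
      forwardMass (alongInstance Ψ ρ p) (K.agrees Ω.label) K.init (d + 1) s := fun s =>
    continuous_forwardMass (fun k s s' => by unfold alongInstance; fun_prop) _ _ _ _
  set T : ℕ → S → S → ℝ := fun k s s' =>
    K.transientMatrix (ρ.1.stageTime (k + 1) - ρ.1.stageTime k) s s' with hT
  -- The support is common to all admissible functions, so the denominator vanishes identically or
  -- nowhere. In the first case the value is constantly 0, in the second it is a continuous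
  -- quotient.
  have hzero : ∀ p ∈ toArray '' (K.abstraction Ψ).admissible,
      (∑ s, forwardMass (alongInstance Ψ ρ p) (K.agrees Ω.label) K.init (d + 1) s = 0
        ↔ ∑ s, forwardMass T (K.agrees Ω.label) K.init (d + 1) s = 0) := by
    rintro _ ⟨P, hP, rfl⟩
    have hAnn : ∀ k < d + 1, ∀ s s', 0 ≤ alongInstance Ψ ρ (toArray P) k s s' :=
      fun k _ s s' => ENNReal.toReal_nonneg
    have hTnn : ∀ k < d + 1, ∀ s s', 0 ≤ T k s s' := fun k _ s s' =>
      K.transientMatrix_nonneg _ _ _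
    rw [Finset.sum_eq_zero_iff_of_nonneg fun s _ => forwardMass_nonneg hAnn _ le_rfl s,
      Finset.sum_eq_zero_iff_of_nonneg fun s _ => forwardMass_nonneg hTnn _ le_rfl s]
    refine forall_congr' fun s => forall_congr' fun _ => ⟨?_, ?_⟩
    · exact forwardMass_eq_zero_of_support trivial hAnn (fun k hk s hs s' =>
        (K.admissible_support hP (by omega) hs s').1) _ le_rfl s
    · exact forwardMass_eq_zero_of_support trivial hTnn (fun k hk s hs s' =>
        (K.admissible_support hP (by omega) hs s').2) _ le_rfl s
  have hF : ContinuousOn (fun p => K.filterValue w Ω.label (alongInstance Ψ ρ p))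
      (toArray '' (K.abstraction Ψ).admissible) := by
    by_cases hD : ∑ s, forwardMass T (K.agrees Ω.label) K.init (d + 1) s = 0
    · refine (continuousOn_const (c := (0 : ℝ))).congr fun p hp => ?_
      simp only [filterValue, (hzero p hp).2 hD, div_zero, zero_mul, Finset.sum_const_zero]
    · unfold filterValue
      refine continuousOn_finsetSum _ fun s _ => ContinuousOn.mul (ContinuousOn.div
        (hcont s).continuousOn (continuous_finsetSum _ fun s _ => hcont s).continuousOn
        fun p hp h => hD ((hzero p hp).1 h)) continuousOn_const
  rw [himage] at hne ⊢
  exact ⟨(hcompact.image_of_continuousOn hF).exists_isLeast hne,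
    (hcompact.image_of_continuousOn hF).exists_isGreatest hne⟩

end CTMC

theorem theorem3 {S C : Type*} [Fintype S] [DecidableEq S] [MeasurableSpace S]
    [MeasurableSingletonClass S] (K : CTMC S C) (w : S → ℝ≥0) {d : ℕ}
    (Ω : ImpreciseEvidence C d) (Ψ : TimePartition Ω) :
    IsLUB (K.instanceWeight w '' Ω.instances) (K.weight w Ω) ∧
    ∃ m M : (K.abstraction Ψ).consistentSchedulers → ℝ,
      (∀ σ : (K.abstraction Ψ).consistentSchedulers,
        IsLeast ((fun P => K.abstractWeight w Ψ P σ) '' (K.abstraction Ψ).admissible)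
          (m σ)) ∧
      (∀ σ : (K.abstraction Ψ).consistentSchedulers,
        IsGreatest ((fun P => K.abstractWeight w Ψ P σ) '' (K.abstraction Ψ).admissible)
          (M σ)) ∧
      ∃ lower upper : ℝ,
        IsGreatest (Set.range m) lower ∧ IsGreatest (Set.range M) upper ∧
        lower ≤ K.weight w Ω ∧ K.weight w Ω ≤ upper := by
  have hlub : IsLUB (K.instanceWeight w '' Ω.instances) (K.weight w Ω) := by
    refine isLUB_csSup (Ω.instances_nonempty.image _) ⟨∑ s, (w s : ℝ), ?_⟩
    rintro _ ⟨ρ, _, rfl⟩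
    exact K.instanceWeight_le w ρ
  refine ⟨hlub, ?_⟩
  have hex : ∀ σ : (K.abstraction Ψ).consistentSchedulers, _ := fun σ =>
    K.exists_isLeast_isGreatest_abstractWeight Ψ w
      (K.exists_instance_of_scheduler Ψ σ.2).choose_spec
  choose m hm using fun σ => (hex σ).1
  choose M hM using fun σ => (hex σ).2
  have hne : Nonempty (K.abstraction Ψ).consistentSchedulers := by
    obtain ⟨σ, hσ, _⟩ := K.exists_scheduler_of_instance Ψ
      ⟨_, Ω.instances_nonempty.some_mem⟩
    exact ⟨⟨σ, hσ⟩⟩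
  -- There are finitely many states and partition elements, hence finitely many schedulers.
  obtain ⟨σ₁, hσ₁⟩ := Finite.exists_max m
  obtain ⟨σ₂, hσ₂⟩ := Finite.exists_max M
  refine ⟨m, M, hm, hM, m σ₁, M σ₂, ⟨⟨σ₁, rfl⟩, forall_mem_range.2 hσ₁⟩,
    ⟨⟨σ₂, rfl⟩, forall_mem_range.2 hσ₂⟩, ?_, ?_⟩
  -- Lower bound: the instance followed by the optimal scheduler has a weight that is at least the
  -- minimum. For the upper bound, conversely, every instance is followed by some scheduler.
  · obtain ⟨ρ, hρ⟩ := K.exists_instance_of_scheduler Ψ σ₁.2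
    exact ((hm σ₁).2 (K.instanceWeight_mem_image Ψ w hρ)).trans
      (hlub.1 (mem_image_of_mem _ ρ.2))
  · refine hlub.2 ?_
    rintro _ ⟨ρ, hρ, rfl⟩
    obtain ⟨σ, hσ, hf⟩ := K.exists_scheduler_of_instance Ψ ⟨ρ, hρ⟩
    exact ((hM ⟨σ, hσ⟩).2 (K.instanceWeight_mem_image Ψ w hf)).trans (hσ₂ ⟨σ, hσ⟩)
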